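/- \textbf{Definitions.} A \emph{PO system} is a set $P$ with a transitive antisymmetric relation $<$ (possibly $p<p$); $p\leqslant q$ means $p<q$ or $p=q$, and $P^{d}=\{p\in P: p\not<p\}$. An \emph{ideal} of $P$ is a nonempty, lower, upward directed subset. The \emph{ideal completion} $\mathrm{id}(P)$ is the set of ideals of $P$, made a PO system by letting $J<K$ iff either $J\subsetneq K$, or $J=K$ and $J$ is not of the form $\{q: q\leqslant p\}$ with $p\in P^{d}$. Let $W$ be an $\omega$-Stone space, i.e. a locally compact, totally disconnected Hausdorff space whose Boolean ring $\mathrm{Co}(W)$ of compact open sets is countable. $S'$ denotes the derived set of $S\subseteq W$. A \emph{$P$-partition} of $W$ is a family $\mathscr X=\{X_p: p\in P\}$ of nonempty, pairwise disjoint subsets, indexed by a PO system $P$, such that with $X=\bigcup_pX_p$ (not necessarily all of $W$) we have $X_p'\cap X=\bigcup_{q<p}X_q$ for all $p$; it is \emph{complete} if $X=W$. For $A\subseteq W$ let $T_{\mathscr X}(A)=\{p: A\cap X_p\ne\emptyset\}$. A compact open $A$ is \emph{$p$-trim} if $T_{\mathscr X}(A)=\{q: q\geqslant p\}$ and, if $p\in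 P^{d}$, $|A\cap X_p|=1$; it is \emph{trim} if it is $p$-trim for some $p$. A $P$-partition is \emph{trim} if (T1) every $w\in W$ has a neighbourhood base of trim sets; (T2) for each $p$ such that $p$-trim sets exist, every $w\in W$ with a neighbourhood base of $p$-trim sets lies in $X_p$; (T3) every $w\in X_p$ has a $p$-trim neighbourhood. The \emph{ideal completion} of a trim $P$-partition $\mathscr X$ is $\mathrm{id}(\mathscr X)=\{Y(J): J\in\mathrm{id}(P)\}$, where $Y(J)=\{w: I_w=J\}$ and $I_w=\{p: w\text{ has a }p\text{-trim neighbourhood}\}$. If $\mathscr Z$ is a $P$-partition and $\mathscr Y$ a $Q$-partition of $W$, both satisfying T1, then $\mathscr Z$ \emph{regularly consolidates} $\mathscr Y$ if there is a map $\alpha\colon Q\to P$ with $Y_q\subseteq Z_{\alpha(q)}$ for all $q\in Q$, and $p\in\alpha(T_{\mathscr Y}(A))$ whenever $A$ is $p$-trim for $\mathscr Z$. For $A\in\mathrm{Co}(W)$ let $(A)=\{C\in\mathrm{Co}(W): C\subseteq A\}$, with isomorphism class $[A]$. $A$ is \emph{pseudo-indecomposable (PI)} if $A\neq\emptyset$ and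 for all $B\subseteq A$ in $\mathrm{Co}(W)$ either $(B)\cong(A)$ or $(A\setminus B)\cong(A)$. $W$ is \emph{primitive} if every compact open set is a disjoint union of finitely many PI sets. The \emph{structure diagram} is $\mathscr S(W)=\{[A]: A\text{ PI}\}$ with $[A]<[B]$ iff $(A)\times(B)\cong(A)$. The \emph{canonical partition} is $\mathscr X(W)=\{X_p: p\in\mathscr S(W)\}$, where $X_p$ is the set of points with a neighbourhood base of compact open sets of class $p$. The \emph{orbit diagram} $\mathscr O(W)$ is the set of orbits of points of $W$ under the group of self-homeomorphisms of $W$, with $[w]<[x]$ iff some point of $[w]$ is a limit point of $[x]$. The \emph{prime TBA} $\mathscr U(W)$ is the smallest family of subsets of $W$ closed under complements, arbitrary unions and derived sets; $Fi(W)$ is the family of subsets of $W$ invariant under all self-homeomorphisms of $W$. \textbf{Theorem.} Let $W$ be a primitive $\omega$-Stone space. \begin{enumerate} \item The canonical partition $\mathscr X(W)$ is a trim $\mathscr S(W)$-partition, $\mathscr O(W)$ is a PO system, and $\mathrm{id}(\mathscr X(W))$ is the orbit diagram $\mathscr O(W)$: $J\mapsto Y(J)$ is a bijection from $\mathrm{id}(\mathscr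 S(W))$ onto $\mathscr O(W)$, and $J<K$ iff $Y(J)<Y(K)$. \item For every PO system $Q$ and every trim $Q$-partition $\mathscr Y$ of $W$, $\mathrm{id}(\mathscr Y)$ is a complete $\mathrm{id}(Q)$-partition of $W$, and $\mathscr O(W)$ regularly consolidates $\mathrm{id}(\mathscr Y)$. \item The atoms of $\mathscr U(W)$ form a partition of $W$, which is equal to $\mathscr O(W)$, and $\mathscr U(W)=Fi(W)$. \end{enumerate} -/

import Mathlib

open TopologicalSpace Topology

namespace PrimitiveSpace

section POSystems

variable {P : Type*}

/-- A PO system: a set with an antisymmetric transitive relation `<`, not assumed irreflexive. -/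
structure IsPOSystem (lt : P → P → Prop) : Prop where
  trans : ∀ p q r, lt p q → lt q r → lt p r
  antisymm : ∀ p q, lt p q → lt q p → p = q

/-- `p ≤ q` in a PO system: `p < q` or `p = q`. -/
def leOf (lt : P → P → Prop) (p q : P) : Prop := lt p q ∨ p = q

/-- The principal ideal generated by `p`. -/
def principalIdeal (lt : P → P → Prop) (p : P) : Set P := {q | leOf lt q p}

/-- Ideals of a PO system: nonempty, lower, upwards directed subsets. -/
structure IsIdeal (lt : P → P → Prop) (J : Set P) : Prop where
  nonempty : J.Nonempty
  lower : ∀ p q, leOf lt p q → q ∈ J → p ∈ J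
  directed : ∀ x ∈ J, ∀ y ∈ J, ∃ z ∈ J, leOf lt x z ∧ leOf lt y z

/-- The underlying set of the ideal completion `id(P)`. -/
def IdealCompletion (lt : P → P → Prop) : Type _ := {J : Set P // IsIdeal lt J}

/-- The PO system relation of `id(P)`: for distinct ideals it is inclusion, and `J < J` holds
unless `J` is the principal ideal of some `p` with `p ≮ p`. -/
def idLT (lt : P → P → Prop) (J K : IdealCompletion lt) : Prop :=
  J.1 ⊂ K.1 ∨ (J = K ∧ ¬ ∃ p, ¬ lt p p ∧ J.1 = principalIdeal lt p)

end POSystems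

section Partitions

variable {W : Type*} [TopologicalSpace W] {P Q : Type*}

/-- `P`-partitions `{X_p ∣ p ∈ P}^*`: `P` is a PO system, the `X_p` are nonempty, pairwise disjoint
and satisfy `X_p' ∩ X = ⋃_{q < p} X_q`, where `X = ⋃_p X_p` need not be the whole space. -/
structure IsPPartition (lt : P → P → Prop) (X : P → Set W) : Prop where
  poSystem : IsPOSystem lt
  nonempty : ∀ p, (X p).Nonempty
  disjoint : ∀ p q, p ≠ q → Disjoint (X p) (X q)
  derived : ∀ p, derivedSet (X p) ∩ (⋃ q, X q) = ⋃ q ∈ {q | lt q p}, X q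

/-- The type `T(A)` of a subset. -/
def typeOf (X : P → Set W) (A : Set W) : Set P := {p | (A ∩ X p).Nonempty}

/-- `A` is `p`-trim: `A` is compact open, `T(A) = p↑`, and `|A ∩ X_p| = 1` if `p ≮ p`. -/
structure IsTrimSet (lt : P → P → Prop) (X : P → Set W) (p : P) (A : Set W) : Prop where
  isCompact : IsCompact A
  isOpen : IsOpen A
  type_eq : typeOf X A = {q | leOf lt p q}
  card_eq : ¬ lt p p → (A ∩ X p).encard = 1

/-- Axiom T1: every point has a neighbourhood base of trim sets. -/
def T1 (lt : P → P → Prop) (X : P → Set W) : Prop :=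
  ∀ w, ∀ U ∈ 𝓝 w, ∃ p A, IsTrimSet lt X p A ∧ w ∈ A ∧ A ⊆ U

/-- Axiom T2 (fullness): for each `p` that is the type of some trim set, a point with a
neighbourhood base of `p`-trim sets lies in `X_p`. -/
def T2 (lt : P → P → Prop) (X : P → Set W) : Prop :=
  ∀ p, (∃ A, IsTrimSet lt X p A) →
    ∀ w, (∀ U ∈ 𝓝 w, ∃ A, IsTrimSet lt X p A ∧ w ∈ A ∧ A ⊆ U) → w ∈ X p

/-- Axiom T3: all points of `X` are clean. -/
def T3 (lt : P → P → Prop) (X : P → Set W) : Prop :=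
  ∀ p, ∀ w ∈ X p, ∃ A, IsTrimSet lt X p A ∧ w ∈ A

/-- Trim `P`-partitions. -/
structure IsTrimPartition (lt : P → P → Prop) (X : P → Set W) : Prop where
  isPPartition : IsPPartition lt X
  t1 : T1 lt X
  t2 : T2 lt X
  t3 : T3 lt X

/-- `I_w`: the types of the trim neighbourhoods of `w`. -/
def trimTypes (lt : P → P → Prop) (X : P → Set W) (w : W) : Set P :=
  {p | ∃ A, IsTrimSet lt X p A ∧ w ∈ A}

/-- The ideal completion `id(𝒳) = {Y(J) ∣ J ∈ id(P)}`, with `Y(J) = {w ∣ I_w = J}`. -/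
def idPartition (lt : P → P → Prop) (X : P → Set W) (J : IdealCompletion lt) : Set W :=
  {w | trimTypes lt X w = J.1}

/-- The `Q`-partition `Y` regularly refines the `P`-partition `Z` via `α`, that is, `Z` regularly
consolidates `Y` via `α`. -/
structure RegularlyRefines (ltQ : Q → Q → Prop) (Y : Q → Set W)
    (ltP : P → P → Prop) (Z : P → Set W) (α : Q → P) : Prop where
  isPPartition_fine : IsPPartition ltQ Y
  isPPartition_coarse : IsPPartition ltP Z
  t1_fine : T1 ltQ Y
  t1_coarse : T1 ltP Z
  refines : ∀ q, Y q ⊆ Z (α q)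
  regular : ∀ p A, IsTrimSet ltP Z p A → p ∈ α '' typeOf Y A

end Partitions

section Canonical

variable (W : Type*) [TopologicalSpace W]

variable {W} in
/-- `(A) ≅ (B)`, where `(A) = {C ∈ Co(W) ∣ C ⊆ A}`. Isomorphisms of Boolean rings are the
same as isomorphisms of the corresponding ordered sets. -/
def IdealIso (A B : CompactOpens W) : Prop := Nonempty (Set.Iic A ≃o Set.Iic B)

variable {W} in
/-- `A` is pseudo-indecomposable (in particular nonzero). -/
def IsPI [T2Space W] (A : CompactOpens W) : Prop :=
  A ≠ ⊥ ∧ ∀ B ≤ A, IdealIso B A ∨ IdealIso (A \ B) A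

/-- `W` is primitive: each compact open set is a disjoint union of finitely many
pseudo-indecomposable ones. -/
def IsPrimitive [T2Space W] : Prop :=
  ∀ A : CompactOpens W, ∃ s : Finset (CompactOpens W),
    (∀ B ∈ s, IsPI B) ∧ (s : Set (CompactOpens W)).PairwiseDisjoint id ∧ s.sup id = A

/-- The relation `(A) ≅ (B)` on pseudo-indecomposable compact open sets. -/
def piSetoid [T2Space W] : Setoid {A : CompactOpens W // IsPI A} where
  r A B := IdealIso A.1 B.1
  iseqv :=
    { refl := fun _ => ⟨OrderIso.refl _⟩
      symm := fun ⟨e⟩ => ⟨e.symm⟩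
      trans := fun ⟨e⟩ ⟨f⟩ => ⟨e.trans f⟩ }

/-- The underlying set of the structure diagram: isomorphism classes `[A]` of `(A)`, for
pseudo-indecomposable `A`. -/
def StructureDiagram [T2Space W] : Type _ := Quotient (piSetoid W)

/-- Products of isomorphic ordered sets are isomorphic. -/
def prodOrderIso {α β γ δ : Type*} [LE α] [LE β] [LE γ] [LE δ] (e : α ≃o β) (f : γ ≃o δ) :
    α × γ ≃o β × δ where
  toEquiv := Equiv.prodCongr e.toEquiv f.toEquiv
  map_rel_iff' := by
    rintro ⟨a, c⟩ ⟨a', c'⟩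
    simp [Prod.le_def]

variable {W} in
/-- The class `[A]`. -/
def isoClass [T2Space W] (A : CompactOpens W) (hA : IsPI A) : StructureDiagram W :=
  Quotient.mk (piSetoid W) ⟨A, hA⟩

/-- `[A] < [B]` if and only if `(A) × (B) ≅ (A)`. -/
def structureLT [T2Space W] : StructureDiagram W → StructureDiagram W → Prop :=
  Quotient.lift₂ (fun A B => Nonempty (Set.Iic A.1 × Set.Iic B.1 ≃o Set.Iic A.1)) (by
    rintro A B A' B' ⟨e⟩ ⟨f⟩
    refine propext ⟨?_, ?_⟩
    · rintro ⟨g⟩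
      exact ⟨((prodOrderIso e.symm f.symm).trans g).trans e⟩
    · rintro ⟨g⟩
      exact ⟨((prodOrderIso e f).trans g).trans e.symm⟩)

/-- The canonical partition: `X_p` is the set of points with a neighbourhood base of (compact
open) sets of isomorphism class `p`. -/
def canonicalPartition [T2Space W] (p : StructureDiagram W) : Set W :=
  {w | ∀ U ∈ 𝓝 w, ∃ (A : CompactOpens W) (hA : IsPI A), isoClass A hA = p ∧
    w ∈ A ∧ (A : Set W) ⊆ U}

end Canonical

section Orbits

variable (W : Type*) [TopologicalSpace W]

variable {W} in
/-- The orbit of `w` under the homeomorphisms of `W`. -/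
def homeoOrbit (w : W) : Set W := {x | ∃ h : W ≃ₜ W, h w = x}

/-- The orbit diagram `𝒪(W)`, as a set of subsets of `W`. -/
def orbitDiagram : Set (Set W) := Set.range (homeoOrbit (W := W))

/-- `[w] < [x]` if some point of `[w]` is a limit of distinct points of `[x]`. -/
def orbitLT (S T : orbitDiagram W) : Prop := ∃ y ∈ S.1, y ∈ derivedSet T.1

/-- The partition of `W` into orbits, indexed by `𝒪(W)` itself. -/
def orbitPartition (S : orbitDiagram W) : Set W := S.1

/-- Complete sub-TBAs of `2^W`: families of subsets closed under complements, arbitrary unions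
(hence arbitrary intersections) and derived sets. -/
structure IsCompleteSubTBA (F : Set (Set W)) : Prop where
  compl_mem : ∀ A ∈ F, Aᶜ ∈ F
  sUnion_mem : ∀ G ⊆ F, ⋃₀ G ∈ F
  derivedSet_mem : ∀ A ∈ F, derivedSet A ∈ F

/-- The prime TBA `𝒰(W)`: the smallest complete sub-TBA of `2^W`. -/
def primeTBA : Set (Set W) := {A | ∀ F, IsCompleteSubTBA W F → A ∈ F}

/-- The atoms of `𝒰(W)`: its minimal nonempty elements. -/
def primeTBAAtoms : Set (Set W) := {A | Minimal (fun B => B ∈ primeTBA W ∧ B.Nonempty) A}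

/-- `Fi(W)`: the subsets invariant under all homeomorphisms of `W`. -/
def invariantSets : Set (Set W) := {A | ∀ h : W ≃ₜ W, h '' A = A}

end Orbits

end PrimitiveSpace

open PrimitiveSpace

/-! Everything rests on one uniqueness and one existence statement about partitions satisfying T1
and T3 (`IsPretrim`); fullness T2 is not needed for either. Write `I_w` for `trimTypes lt X w`.

Uniqueness: if `I_w = I_x`, some homeomorphism carries `w` to `x` (`IsPretrim.exists_homeomorph`).
Every compact open set is a finite disjoint union of trim sets (`IsPretrim.isTrimSum`), and a
`p`-trim set can give up a `q`-trim piece for any `q > p` and remain `p`-trim. Hence "disjoint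
unions of trim pieces of matching types, with `w` and `x` in corresponding pieces" is a
back-and-forth relation. Vaught's theorem turns it into an isomorphism of Boolean rings, and Stone
duality turns that into a homeomorphism. The same argument shows that trim sets of equal type are
isomorphic (`IsPretrim.idealIso`).

Existence: each ideal `J` equals `I_y` for some `y` in any prescribed trim set of type in `J`
(`IsPretrim.exists_trimTypes_eq`), by a decreasing sequence of trim sets that decides every compact
open set. With T2 this makes the sets `Y(J)` a complete partition with the expected limit relation,
and uniqueness puts each `Y(J)` inside one orbit, which gives the consolidation statement.

For the canonical partition, the `p`-trim sets are exactly the PI sets of class `p`. So `I_w` is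
invariant under homeomorphisms, and the sets `Y(J)` are precisely the orbits.

Members of the prime TBA are clearly invariant; conversely each orbit must be shown to belong to it.
Points are grouped by the closure of their atom. The groups that contain a point of the canonical
partition again satisfy T1 and T3, with PI sets as trim sets, so uniqueness recovers the PI class
from the group (`canonicalPartition_eq_closureClass`). Thus each `X_p` lies in the prime TBA, then
so does each set `{w | p ∈ I_w}`, and orbits are intersections of these sets and their complements.
-/

namespace PrimitiveSpace

/-! ### Back-and-forth for countable generalized Boolean algebras -/

section Vaught

variable {α β : Type*} [GeneralizedBooleanAlgebra α] [GeneralizedBooleanAlgebra β]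

/-- An additive relation between generalized Boolean algebras with the back-and-forth property. -/
structure IsVaughtRelation (R : α → β → Prop) : Prop where
  bot : R ⊥ ⊥
  eq_bot_iff : ∀ a b, R a b → (a = ⊥ ↔ b = ⊥)
  sup : ∀ a b a' b', R a b → R a' b' → Disjoint a a' → Disjoint b b' → R (a ⊔ a') (b ⊔ b')
  split_left : ∀ a b, R a b → ∀ c ≤ a, ∃ d ≤ b, R c d ∧ R (a \ c) (b \ d)
  split_right : ∀ a b, R a b → ∀ d ≤ b, ∃ c ≤ a, R c d ∧ R (a \ c) (b \ d)

theorem IsVaughtRelation.flip {R : α → β → Prop} (h : IsVaughtRelation R) :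
    IsVaughtRelation (fun b a => R a b) where
  bot := h.bot
  eq_bot_iff a b hab := (h.eq_bot_iff b a hab).symm
  sup a b a' b' h₁ h₂ h₃ h₄ := h.sup b a b' a' h₁ h₂ h₄ h₃
  split_left a b hab := h.split_right b a hab
  split_right a b hab := h.split_left b a hab

/-- `L` lists matching pieces of partitions of `a` and `b`. -/
inductive RelPartition (R : α → β → Prop) : List (α × β) → α → β → Prop
  | nil : RelPartition R [] ⊥ ⊥
  | cons {p : α} {q : β} {L : List (α × β)} {a : α} {b : β} : R p q → Disjoint p a → Disjoint q b →
      RelPartition R L a b → RelPartition R ((p, q) :: L) (p ⊔ a) (q ⊔ b)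

/-- `x` and `y` are unions of corresponding pieces of `L`. -/
def Captures (L : List (α × β)) (x : α) (y : β) : Prop :=
  ∀ r ∈ L, (r.1 ≤ x ∧ r.2 ≤ y) ∨ (Disjoint r.1 x ∧ Disjoint r.2 y)

/-- Each piece of `L'` lies in a piece of `L`. -/
def ListRefines (L' L : List (α × β)) : Prop :=
  ∀ r' ∈ L', ∃ r ∈ L, r'.1 ≤ r.1 ∧ r'.2 ≤ r.2

theorem ListRefines.refl (L : List (α × β)) : ListRefines L L :=
  fun r hr => ⟨r, hr, le_rfl, le_rfl⟩

theorem ListRefines.trans {L₁ L₂ L₃ : List (α × β)} (h : ListRefines L₁ L₂)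
    (h' : ListRefines L₂ L₃) : ListRefines L₁ L₃ := by
  intro r hr
  obtain ⟨s, hs, h1, h2⟩ := h r hr
  obtain ⟨t, ht, h3, h4⟩ := h' s hs
  exact ⟨t, ht, h1.trans h3, h2.trans h4⟩

theorem Captures.mono {L' L : List (α × β)} {x : α} {y : β} (h : Captures L x y)
    (hL : ListRefines L' L) : Captures L' x y := by
  intro r hr
  obtain ⟨s, hs, h1, h2⟩ := hL r hr
  rcases h s hs with ⟨h3, h4⟩ | ⟨h3, h4⟩
  · exact Or.inl ⟨h1.trans h3, h2.trans h4⟩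
  · exact Or.inr ⟨h3.mono_left h1, h4.mono_left h2⟩

variable {R : α → β → Prop}

theorem RelPartition.le {L : List (α × β)} {a : α} {b : β} (h : RelPartition R L a b) :
    ∀ r ∈ L, r.1 ≤ a ∧ r.2 ≤ b := by
  induction h with
  | nil => simp
  | cons _ _ _ _ ih =>
    intro r hr
    rcases List.mem_cons.1 hr with rfl | hr
    · exact ⟨le_sup_left, le_sup_left⟩
    · exact ⟨(ih r hr).1.trans le_sup_right, (ih r hr).2.trans le_sup_right⟩

theorem RelPartition.rel {L : List (α × β)} {a : α} {b : β} (h : RelPartition R L a b) :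
    ∀ r ∈ L, R r.1 r.2 := by
  induction h with
  | nil => simp
  | cons h _ _ _ ih =>
    intro r hr
    rcases List.mem_cons.1 hr with rfl | hr
    · exact h
    · exact ih r hr

theorem RelPartition.le_right_of_forall {L : List (α × β)} {a : α} {b : β}
    (h : RelPartition R L a b) {y : β} (hy : ∀ r ∈ L, r.2 ≤ y) : b ≤ y := by
  induction h with
  | nil => exact bot_le
  | cons _ _ _ _ ih =>
    exact sup_le (hy _ List.mem_cons_self) (ih fun r hr => hy r (List.mem_cons_of_mem _ hr))

theorem RelPartition.swap {L : List (α × β)} {a : α} {b : β} (h : RelPartition R L a b) :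
    RelPartition (fun b a => R a b) (L.map Prod.swap) b a := by
  induction h with
  | nil => exact .nil
  | cons h h₁ h₂ _ ih => exact .cons h h₂ h₁ ih

theorem Captures.swap {L : List (α × β)} {x : α} {y : β} (h : Captures L x y) :
    Captures (L.map Prod.swap) y x := by
  intro r hr
  obtain ⟨s, hs, rfl⟩ := List.mem_map.1 hr
  exact (h s hs).imp And.symm And.symm

theorem ListRefines.swap {L' L : List (α × β)} (h : ListRefines L' L) :
    ListRefines (L'.map Prod.swap) (L.map Prod.swap) := by
  intro r hr
  obtain ⟨s, hs, rfl⟩ := List.mem_map.1 hr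
  obtain ⟨t, ht, h1, h2⟩ := h s hs
  exact ⟨t.swap, List.mem_map_of_mem ht, h2, h1⟩

/-- Cut every matched pair `(p, q)` along `c`: `split_left` supplies a partner `d ≤ q` for `c ⊓ p`
and matches the remainders. The partner of `c` is the join of these `d`. -/
theorem RelPartition.exists_refine_left (hR : IsVaughtRelation R) {L : List (α × β)} {a : α}
    {b : β} (h : RelPartition R L a b) : ∀ c ≤ a, ∃ L' y, RelPartition R L' a b ∧
      ListRefines L' L ∧ y ≤ b ∧ Captures L' c y := by
  induction h with
  | nil =>
    intro c _
    exact ⟨[], ⊥, .nil, .refl _, le_rfl, by simp [Captures]⟩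
  | @cons p q L a b hpq hpa hqb hL ih =>
    intro c hc
    obtain ⟨d, hd, hR₁, hR₂⟩ := hR.split_left p q hpq (c ⊓ p) inf_le_right
    obtain ⟨L₂, y, hL₂, href, hy, hcap⟩ := ih (c ⊓ a) inf_le_right
    have hle := hL₂.le
    refine ⟨(c ⊓ p, d) :: (p \ (c ⊓ p), q \ d) :: L₂, d ⊔ y, ?_, ?_, ?_, ?_⟩
    · have h1 : p ⊔ a = c ⊓ p ⊔ (p \ (c ⊓ p) ⊔ a) := by
        rw [← sup_assoc, sup_sdiff_cancel_right inf_le_right]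
      have h2 : q ⊔ b = d ⊔ (q \ d ⊔ b) := by
        rw [← sup_assoc, sup_sdiff_cancel_right hd]
      rw [h1, h2]
      refine .cons hR₁ ?_ ?_ (.cons hR₂ (hpa.mono_left sdiff_le) (hqb.mono_left sdiff_le) hL₂)
      · exact disjoint_sup_right.2 ⟨disjoint_sdiff_self_right, hpa.mono_left inf_le_right⟩
      · exact disjoint_sup_right.2 ⟨disjoint_sdiff_self_right, hqb.mono_left hd⟩
    · intro r hr
      simp only [List.mem_cons] at hr
      rcases hr with rfl | rfl | hr
      · exact ⟨(p, q), List.mem_cons_self, inf_le_right, hd⟩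
      · exact ⟨(p, q), List.mem_cons_self, sdiff_le, sdiff_le⟩
      · obtain ⟨s, hs, h⟩ := href r hr
        exact ⟨s, List.mem_cons_of_mem _ hs, h⟩
    · exact sup_le_sup hd hy
    · intro r hr
      simp only [List.mem_cons] at hr
      rcases hr with rfl | rfl | hr
      · exact Or.inl ⟨inf_le_left, le_sup_left⟩
      · refine Or.inr ⟨?_, ?_⟩
        · rw [disjoint_iff_inf_le]
          calc p \ (c ⊓ p) ⊓ c ≤ p \ (c ⊓ p) ⊓ (c ⊓ p) :=
                le_inf inf_le_left (le_inf inf_le_right (inf_le_left.trans sdiff_le))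
            _ ≤ ⊥ := disjoint_iff_inf_le.1 disjoint_sdiff_self_left
        · exact disjoint_sup_right.2 ⟨disjoint_sdiff_self_left, (hqb.mono sdiff_le hy)⟩
      · rcases hcap r hr with ⟨h1, h2⟩ | ⟨h1, h2⟩
        · exact Or.inl ⟨h1.trans inf_le_left, h2.trans le_sup_right⟩
        · refine Or.inr ⟨?_, ?_⟩
          · rw [disjoint_iff_inf_le] at h1 ⊢
            exact (le_inf inf_le_left (le_inf inf_le_right
              (inf_le_left.trans (hle r hr).1))).trans h1
          · exact disjoint_sup_right.2 ⟨(hqb.mono hd (hle r hr).2).symm, h2⟩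

theorem RelPartition.exists_refine_right (hR : IsVaughtRelation R) {L : List (α × β)} {a : α}
    {b : β} (h : RelPartition R L a b) (d : β) (hd : d ≤ b) : ∃ L' x, RelPartition R L' a b ∧
      ListRefines L' L ∧ x ≤ a ∧ Captures L' x d := by
  obtain ⟨L', x, h1, h2, h3, h4⟩ := h.swap.exists_refine_left hR.flip d hd
  refine ⟨L'.map Prod.swap, x, h1.swap, ?_, h3, h4.swap⟩
  have := h2.swap
  simpa using this

/-- A piece inside `x` also lies inside `x'`. If it were disjoint from `x'` it would be zero, and
then its partner is zero by `eq_bot_iff`. So the partner of every piece is below `y'` or misses `y`,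
and these partners together cover `b`. -/
theorem Captures.le_of_le {L : List (α × β)} {a : α} {b : β} (hR : IsVaughtRelation R)
    (hL : RelPartition R L a b) {x x' : α} {y y' : β} (h : Captures L x y) (h' : Captures L x' y')
    (hy : y ≤ b) (hx : x ≤ x') : y ≤ y' := by
  have key : b ≤ y' ⊔ (b \ y) := by
    refine hL.le_right_of_forall fun r hr => ?_
    have hbot := hR.eq_bot_iff _ _ (hL.rel r hr)
    rcases h r hr with ⟨h1, h2⟩ | ⟨h1, h2⟩
    · rcases h' r hr with ⟨h3, h4⟩ | ⟨h3, h4⟩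
      · exact h4.trans le_sup_left
      · rw [hbot.1 (h3.eq_bot_of_le (h1.trans hx))]
        exact bot_le
    · exact le_sup_of_le_right (le_sdiff.2 ⟨(hL.le r hr).2, h2⟩)
  have h2 : y ≤ (y' ⊔ b \ y) ⊓ y := le_inf (hy.trans key) le_rfl
  rw [inf_sup_right, inf_comm (b \ y), inf_sdiff_self_right, sup_bot_eq] at h2
  exact h2.trans inf_le_left

theorem Captures.rel {L : List (α × β)} {a : α} {b : β} (hR : IsVaughtRelation R)
    (hL : RelPartition R L a b) {x : α} {y : β} (h : Captures L x y) :
    R (x ⊓ a) (y ⊓ b) := by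
  induction hL with
  | nil => simpa using hR.bot
  | @cons p q L a b hpq hpa hqb hL ih =>
    have ih' := ih fun r hr => h r (List.mem_cons_of_mem _ hr)
    rw [inf_sup_left, inf_sup_left]
    refine hR.sup _ _ _ _ ?_ ih' (hpa.mono inf_le_right inf_le_right)
      (hqb.mono inf_le_right inf_le_right)
    rcases h (p, q) List.mem_cons_self with ⟨h1, h2⟩ | ⟨h1, h2⟩
    · rwa [inf_eq_right.2 h1, inf_eq_right.2 h2]
    · rw [h1.symm.eq_bot, h2.symm.eq_bot]
      exact hR.bot

/-- Vaught's isomorphism theorem for countable generalized Boolean algebras. -/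
theorem IsVaughtRelation.exists_orderIso [Countable α] [Countable β] (hR : IsVaughtRelation R)
    {a : α} {b : β} (hab : R a b) :
    ∃ f : Set.Iic a ≃o Set.Iic b, ∀ c : Set.Iic a, R c (f c) := by
  obtain ⟨c, hc⟩ := exists_surjective_nat α
  obtain ⟨d, hd⟩ := exists_surjective_nat β
  -- Stage `n` refines the current matching so as to capture the `n`-th element of each algebra, cut
  -- down to `a` and `b`.
  have step : ∀ (n : ℕ) (L : {L // RelPartition R L a b}), ∃ L' : {L // RelPartition R L a b},
      ListRefines L'.1 L.1 ∧ (∃ y ≤ b, Captures L'.1 (c n ⊓ a) y) ∧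
        ∃ x ≤ a, Captures L'.1 x (d n ⊓ b) := by
    rintro n ⟨L, hL⟩
    obtain ⟨L₁, y, hL₁, h1, hy, h2⟩ := hL.exists_refine_left hR (c n ⊓ a) inf_le_right
    obtain ⟨L₂, x, hL₂, h3, hx, h4⟩ := hL₁.exists_refine_right hR (d n ⊓ b) inf_le_right
    exact ⟨⟨L₂, hL₂⟩, h3.trans h1, ⟨y, hy, h2.mono h3⟩, x, hx, h4⟩
  choose next hnext hleft hright using step
  have h0 : RelPartition R [(a, b)] a b := by
    have := RelPartition.cons hab disjoint_bot_right disjoint_bot_right (RelPartition.nil (R := R))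
    simpa using this
  let S : ℕ → {L // RelPartition R L a b} := fun n => Nat.rec ⟨_, h0⟩ (fun n L => next n L) n
  have hS : ∀ n, S (n + 1) = next n (S n) := fun n => rfl
  have hmono : ∀ m n, m ≤ n → ListRefines (S n).1 (S m).1 := by
    intro m n hmn
    induction n, hmn using Nat.le_induction with
    | base => exact .refl _
    | succ n _ ih => rw [hS]; exact (hnext n _).trans ih
  have hl : ∀ x : Set.Iic a, ∃ y : Set.Iic b, ∃ n, Captures (S n).1 x.1 y.1 := by
    rintro ⟨x, hx⟩
    obtain ⟨n, rfl⟩ := hc x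
    obtain ⟨y, hy, h⟩ := hleft n (S n)
    refine ⟨⟨y, hy⟩, n + 1, ?_⟩
    rw [inf_eq_left.2 (show c n ≤ a from hx)] at h
    exact h
  have hr : ∀ y : Set.Iic b, ∃ x : Set.Iic a, ∃ n, Captures (S n).1 x.1 y.1 := by
    rintro ⟨y, hy⟩
    obtain ⟨n, rfl⟩ := hd y
    obtain ⟨x, hx, h⟩ := hright n (S n)
    refine ⟨⟨x, hx⟩, n + 1, ?_⟩
    rw [inf_eq_left.2 (show d n ≤ b from hy)] at h
    exact h
  -- Two captures made at different stages both persist to the later one, where they can be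
  -- compared. This yields monotonicity both ways, and hence also that `f` and `g` are inverse.
  have hle : ∀ (x x' : Set.Iic a) (y y' : Set.Iic b), (∃ n, Captures (S n).1 x.1 y.1) →
      (∃ n, Captures (S n).1 x'.1 y'.1) → (x ≤ x' ↔ y ≤ y') := by
    rintro x x' y y' ⟨m, hm⟩ ⟨n, hn⟩
    have h1 := hm.mono (hmono m (max m n) (le_max_left _ _))
    have h2 := hn.mono (hmono n (max m n) (le_max_right _ _))
    have hp := (S (max m n)).2
    exact ⟨fun h => h1.le_of_le hR hp h2 y.2 h,
      fun h => h1.swap.le_of_le hR.flip hp.swap h2.swap x.2 h⟩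
  choose f hf using hl
  choose g hg using hr
  refine ⟨⟨⟨f, g, fun x => ?_, fun y => ?_⟩, fun {x x'} => ?_⟩, fun x => ?_⟩
  · exact le_antisymm ((hle _ _ _ _ (hg _) (hf _)).2 le_rfl) ((hle _ _ _ _ (hf _) (hg _)).2 le_rfl)
  · exact le_antisymm ((hle _ _ _ _ (hf _) (hg _)).1 le_rfl) ((hle _ _ _ _ (hg _) (hf _)).1 le_rfl)
  · exact (hle _ _ _ _ (hf _) (hf _)).symm
  · obtain ⟨n, hn⟩ := hf x
    have := hn.rel hR (S n).2
    rwa [inf_eq_left.2 (show x.1 ≤ a from x.2), inf_eq_left.2 (show (f x).1 ≤ b from (f x).2)]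
      at this

end Vaught

/-! ### Stone duality: from isomorphisms of compact open sets to homeomorphisms -/

section Stone

variable {W : Type*} [TopologicalSpace W]

theorem compactOpens_ext {A B : CompactOpens W} (h : ∀ w, w ∈ A ↔ w ∈ B) : A = B :=
  SetLike.ext h

theorem compactOpens_mem_sup {A B : CompactOpens W} {w : W} : w ∈ A ⊔ B ↔ w ∈ A ∨ w ∈ B := Iff.rfl

theorem compactOpens_ne_bot_iff {A : CompactOpens W} : A ≠ ⊥ ↔ ∃ w, w ∈ A := by
  rw [← not_iff_not]
  push Not
  constructor
  · rintro rfl w hw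
    exact hw
  · intro h
    exact SetLike.ext fun w => ⟨fun hw => (h w hw).elim, fun hw => hw.elim⟩

theorem compactOpens_mem_finset_sup (s : Finset (CompactOpens W)) (w : W) :
    w ∈ s.sup id ↔ ∃ A ∈ s, w ∈ A := by
  classical
  induction s using Finset.induction_on with
  | empty => exact ⟨fun hw => hw.elim, fun ⟨A, hA, _⟩ => by simp at hA⟩
  | insert A s _ ih => simp [compactOpens_mem_sup, ih]

variable [T2Space W]

theorem compactOpens_mem_sdiff {A B : CompactOpens W} {w : W} : w ∈ A \ B ↔ w ∈ A ∧ w ∉ B := Iff.rfl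

theorem compactOpens_disjoint_iff {A B : CompactOpens W} : Disjoint A B ↔ ∀ w ∈ A, w ∉ B := by
  rw [disjoint_iff_inf_le]
  exact ⟨fun h w hA hB => (h ⟨hA, hB⟩ : w ∈ (⊥ : CompactOpens W)), fun h w hw => h w hw.1 hw.2⟩

/-- An isomorphism between disjoint principal ideals extends to an involution. -/
theorem exists_orderIso_extending {A B : CompactOpens W} (hAB : Disjoint A B)
    (f : Set.Iic A ≃o Set.Iic B) :
    ∃ φ : CompactOpens W ≃o CompactOpens W, ∀ C : Set.Iic A, φ C.1 = (f C).1 := by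
  let F : CompactOpens W → CompactOpens W := fun C => (f ⟨C ⊓ A, Set.mem_Iic.2 inf_le_right⟩).1
  let G : CompactOpens W → CompactOpens W := fun C => (f.symm ⟨C ⊓ B, Set.mem_Iic.2 inf_le_right⟩).1
  have hF : ∀ C, F C ≤ B := fun C => (f ⟨C ⊓ A, Set.mem_Iic.2 inf_le_right⟩).2
  have hG : ∀ C, G C ≤ A := fun C => (f.symm ⟨C ⊓ B, Set.mem_Iic.2 inf_le_right⟩).2
  have hFm : Monotone F := fun C D h => f.monotone (Subtype.mk_le_mk.2 (inf_le_inf_right A h))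
  have hGm : Monotone G := fun C D h => f.symm.monotone (Subtype.mk_le_mk.2 (inf_le_inf_right B h))
  have hd := compactOpens_disjoint_iff.1 hAB
  -- Exchange the parts in `A` and `B` through `f` and fix the rest. Since `φ` is its own inverse,
  -- monotonicity suffices for an order isomorphism.
  let φ : CompactOpens W → CompactOpens W := fun C => C \ (A ⊔ B) ⊔ (F C ⊔ G C)
  have hφm : Monotone φ := fun C D h =>
    sup_le_sup (sdiff_le_sdiff_right h) (sup_le_sup (hFm h) (hGm h))
  have hφA : ∀ C, φ C ⊓ A = G C := by
    intro C
    refine compactOpens_ext fun w => ⟨?_, fun h => ⟨Or.inr (Or.inr h), hG C h⟩⟩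
    rintro ⟨(h | h | h), hA⟩
    · exact (h.2 (Or.inl hA)).elim
    · exact (hd w hA (hF C h)).elim
    · exact h
  have hφB : ∀ C, φ C ⊓ B = F C := by
    intro C
    refine compactOpens_ext fun w => ⟨?_, fun h => ⟨Or.inr (Or.inl h), hF C h⟩⟩
    rintro ⟨(h | h | h), hB⟩
    · exact (h.2 (Or.inr hB)).elim
    · exact h
    · exact (hd w (hG C h) hB).elim
  have hφ0 : ∀ C, φ C \ (A ⊔ B) = C \ (A ⊔ B) := by
    intro C
    refine compactOpens_ext fun w => ⟨?_, fun h => ⟨Or.inl h, h.2⟩⟩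
    rintro ⟨(h | h | h), hn⟩
    · exact h
    · exact (hn (Or.inr (hF C h))).elim
    · exact (hn (Or.inl (hG C h))).elim
  have hFφ : ∀ C, F (φ C) = C ⊓ B := by
    intro C
    have : (⟨φ C ⊓ A, Set.mem_Iic.2 inf_le_right⟩ : Set.Iic A) = f.symm ⟨C ⊓ B, Set.mem_Iic.2 inf_le_right⟩ :=
      Subtype.ext (hφA C)
    simp only [F, this, OrderIso.apply_symm_apply]
  have hGφ : ∀ C, G (φ C) = C ⊓ A := by
    intro C
    have : (⟨φ C ⊓ B, Set.mem_Iic.2 inf_le_right⟩ : Set.Iic B) = f ⟨C ⊓ A, Set.mem_Iic.2 inf_le_right⟩ :=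
      Subtype.ext (hφB C)
    simp only [G, this, OrderIso.symm_apply_apply]
  have hinv : ∀ C, φ (φ C) = C := by
    intro C
    change φ C \ (A ⊔ B) ⊔ (F (φ C) ⊔ G (φ C)) = C
    rw [hφ0, hFφ, hGφ, ← inf_sup_left, sup_comm B A, sup_comm, sup_inf_sdiff]
  refine ⟨⟨⟨φ, φ, hinv, hinv⟩, fun {C D} => ⟨fun h => ?_, fun h => hφm h⟩⟩, fun C => ?_⟩
  · have := hφm h
    simpa only [Equiv.coe_fn_mk, hinv] using this
  · have h1 : C.1 \ (A ⊔ B) = ⊥ := sdiff_eq_bot_iff.2 (le_sup_of_le_left C.2)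
    have h2 : G C.1 = ⊥ := by
      have : (⟨C.1 ⊓ B, Set.mem_Iic.2 inf_le_right⟩ : Set.Iic B) = ⊥ :=
        Subtype.ext (hAB.mono_left C.2).eq_bot
      simp only [G, this, map_bot]
      rfl
    have h3 : (⟨C.1 ⊓ A, Set.mem_Iic.2 inf_le_right⟩ : Set.Iic A) = C := Subtype.ext (inf_eq_left.2 C.2)
    change C.1 \ (A ⊔ B) ⊔ ((f ⟨C.1 ⊓ A, Set.mem_Iic.2 inf_le_right⟩).1 ⊔ G C.1) = _
    rw [h1, h2, h3, sup_bot_eq, bot_sup_eq]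

/-- The isomorphism between corresponding principal ideals. -/
def iicOrderIso {α β : Type*} [Preorder α] [Preorder β] (φ : α ≃o β) (a : α) :
    Set.Iic a ≃o Set.Iic (φ a) where
  toFun c := ⟨φ c.1, φ.monotone c.2⟩
  invFun d := ⟨φ.symm d.1, by
    have := φ.symm.monotone (show d.1 ≤ φ a from d.2)
    simpa using this⟩
  left_inv c := by simp
  right_inv d := by simp
  map_rel_iff' {c d} := φ.le_iff_le (x := c.1) (y := d.1)

/-- The automorphism of the Boolean ring of compact open sets induced by a homeomorphism. -/
def mapCompactOpens (h : W ≃ₜ W) : CompactOpens W ≃o CompactOpens W where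
  toFun C := C.map h h.continuous h.isOpenMap
  invFun C := C.map h.symm h.symm.continuous h.symm.isOpenMap
  left_inv C := by
    refine SetLike.coe_injective ?_
    simp [Set.image_image]
  right_inv C := by
    refine SetLike.coe_injective ?_
    simp [Set.image_image]
  map_rel_iff' {C D} := by
    exact Set.image_subset_image_iff h.injective

variable [LocallyCompactSpace W] [TotallyDisconnectedSpace W]

theorem exists_compactOpens_mem_subset {w : W} {U : Set W} (hU : U ∈ 𝓝 w) :
    ∃ A : CompactOpens W, w ∈ A ∧ (A : Set W) ⊆ U := by
  obtain ⟨K, hK, hKU, hKc⟩ := local_compact_nhds hU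
  obtain ⟨V, hV, hwV, hVK⟩ := (loc_compact_Haus_tot_disc_of_zero_dim (H := W)).mem_nhds_iff.1 hK
  exact ⟨⟨⟨V, hKc.of_isClosed_subset hV.1 hVK⟩, hV.2⟩, hwV, hVK.trans hKU⟩

theorem exists_compactOpens_separating {w x : W} (h : w ≠ x) :
    ∃ A : CompactOpens W, w ∈ A ∧ x ∉ A := by
  obtain ⟨A, hA, hAx⟩ := exists_compactOpens_mem_subset (isOpen_compl_singleton.mem_nhds h)
  exact ⟨A, hA, fun hx => hAx hx rfl⟩

/-- The images of the compact open neighbourhoods of `w` are nonempty, compact and downward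
directed, so they have a common point `v`. If `w ∉ C`, then `A₀ \ C` is such a neighbourhood and its
image is disjoint from `φ C`, so `v ∉ φ C`. -/
theorem exists_forall_mem_compactOpens_iff (φ : CompactOpens W ≃o CompactOpens W) (w : W) :
    ∃ v, ∀ C : CompactOpens W, w ∈ C ↔ v ∈ φ C := by
  obtain ⟨A₀, hA₀, -⟩ := exists_compactOpens_mem_subset (Filter.univ_mem (f := 𝓝 w))
  have hne : (⋂ C : {C : CompactOpens W // w ∈ C}, (φ C.1 : Set W)).Nonempty := by
    have : Nonempty {C : CompactOpens W // w ∈ C} := ⟨⟨A₀, hA₀⟩⟩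
    refine IsCompact.nonempty_iInter_of_directed_nonempty_isCompact_isClosed _ ?_ ?_
      (fun C => (φ C.1).isCompact) (fun C => (φ C.1).isCompact.isClosed)
    · intro C D
      exact ⟨⟨C.1 ⊓ D.1, C.2, D.2⟩, φ.monotone inf_le_left, φ.monotone inf_le_right⟩
    · rintro ⟨C, hC⟩
      have : φ C ≠ ⊥ := by
        rw [Ne, map_eq_bot_iff, ← Ne, compactOpens_ne_bot_iff]
        exact ⟨w, hC⟩
      exact compactOpens_ne_bot_iff.1 this
  obtain ⟨v, hv⟩ := hne
  simp only [Set.mem_iInter] at hv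
  refine ⟨v, fun C => ⟨fun hC => hv ⟨C, hC⟩, fun hvC => ?_⟩⟩
  by_contra hC
  have h1 : v ∈ φ (A₀ \ C) := hv ⟨A₀ \ C, hA₀, hC⟩
  have h2 : Disjoint (φ (A₀ \ C)) (φ C) := disjoint_sdiff_self_left.map_orderIso φ
  exact compactOpens_disjoint_iff.1 h2 v h1 hvC

theorem eq_of_forall_mem_compactOpens_iff {w x : W}
    (h : ∀ C : CompactOpens W, w ∈ C ↔ x ∈ C) : w = x := by
  by_contra hne
  obtain ⟨A, hA, hx⟩ := exists_compactOpens_separating hne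
  exact hx ((h A).1 hA)

/-- Stone duality for automorphisms of the Boolean ring of compact open sets. -/
theorem exists_homeomorph_of_orderIso (φ : CompactOpens W ≃o CompactOpens W) :
    ∃ h : W ≃ₜ W, ∀ (w : W) (C : CompactOpens W), w ∈ C ↔ h w ∈ φ C := by
  choose f hf using exists_forall_mem_compactOpens_iff φ
  choose g hg using exists_forall_mem_compactOpens_iff φ.symm
  have hcont : ∀ (ψ : CompactOpens W ≃o CompactOpens W) (k : W → W),
      (∀ (w : W) (C : CompactOpens W), w ∈ C ↔ k w ∈ ψ C) → Continuous k := by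
    intro ψ k hk
    rw [continuous_iff_continuousAt]
    intro w U hU
    obtain ⟨A, hA, hAU⟩ := exists_compactOpens_mem_subset hU
    have hw : w ∈ ψ.symm A := by
      rw [hk]
      simpa using hA
    refine Filter.mem_map.2 <| Filter.mem_of_superset ((ψ.symm A).isOpen.mem_nhds hw) fun v hv => hAU ?_
    have := (hk v _).1 hv
    simpa using this
  refine ⟨⟨⟨f, g, fun w => ?_, fun w => ?_⟩, hcont φ f hf, hcont φ.symm g hg⟩, hf⟩
  · refine eq_of_forall_mem_compactOpens_iff fun C => ?_
    rw [hf w C, hg (f w), φ.symm_apply_apply]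
  · refine eq_of_forall_mem_compactOpens_iff fun C => ?_
    rw [hg w C, hf (g w), φ.apply_symm_apply]

/-- An isomorphism of disjoint compact open sets which matches the neighbourhoods of `w` with those
of `x` is induced by a homeomorphism of the space. -/
theorem exists_homeomorph_apply_eq {A B : CompactOpens W} (hAB : Disjoint A B)
    (f : Set.Iic A ≃o Set.Iic B) {w x : W} (hw : w ∈ A)
    (hf : ∀ C : Set.Iic A, w ∈ C.1 ↔ x ∈ (f C).1) : ∃ h : W ≃ₜ W, h w = x := by
  obtain ⟨φ, hφ⟩ := exists_orderIso_extending hAB f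
  obtain ⟨h, hh⟩ := exists_homeomorph_of_orderIso φ
  refine ⟨h, ?_⟩
  by_contra hne
  obtain ⟨C, hC, hxC⟩ := exists_compactOpens_separating hne
  have h1 : w ∈ φ.symm C := by
    rw [hh]
    simpa using hC
  have h2 := (hh w (φ.symm C ⊓ A)).1 ⟨h1, hw⟩
  have h3 := (hf ⟨φ.symm C ⊓ A, Set.mem_Iic.2 inf_le_right⟩).1 ⟨h1, hw⟩
  rw [← hφ] at h3
  have h4 : φ (φ.symm C ⊓ A) ≤ C := by
    have := φ.monotone (inf_le_left : φ.symm C ⊓ A ≤ φ.symm C)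
    rwa [φ.apply_symm_apply] at this
  exact hxC (h4 h3)

end Stone

/-! ### Order bookkeeping in PO systems -/

section POSystems

variable {P : Type*} {lt : P → P → Prop}

theorem leOf_refl (p : P) : leOf lt p p := Or.inr rfl

theorem IsPOSystem.lt_of_lt_of_le (h : IsPOSystem lt) {p q r : P} (h₁ : lt p q)
    (h₂ : leOf lt q r) : lt p r := by
  rcases h₂ with h₂ | rfl
  · exact h.trans _ _ _ h₁ h₂
  · exact h₁

theorem IsPOSystem.le_trans (h : IsPOSystem lt) {p q r : P} (h₁ : leOf lt p q)
    (h₂ : leOf lt q r) : leOf lt p r := by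
  rcases h₁ with h₁ | rfl
  · exact Or.inl (h.lt_of_lt_of_le h₁ h₂)
  · exact h₂

theorem IsPOSystem.le_antisymm (h : IsPOSystem lt) {p q : P} (h₁ : leOf lt p q)
    (h₂ : leOf lt q p) : p = q := by
  rcases h₁ with h₁ | rfl
  · rcases h₂ with h₂ | rfl
    · exact h.antisymm _ _ h₁ h₂
    · rfl
  · rfl

end POSystems

/-! ### Trim sets: construction, shrinking and splitting -/

section Trim

set_option linter.unusedSectionVars false

variable {W : Type*} [TopologicalSpace W] {P : Type*} {lt : P → P → Prop} {X : P → Set W}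

theorem IsTrimSet.le_of_mem {p q : P} {A : Set W} (h : IsTrimSet lt X p A) {w : W} (hw : w ∈ A)
    (hq : w ∈ X q) : leOf lt p q := by
  have : q ∈ typeOf X A := ⟨w, hw, hq⟩
  rw [h.type_eq] at this
  exact this

theorem IsTrimSet.exists_mem {p q : P} {A : Set W} (h : IsTrimSet lt X p A) (hq : leOf lt p q) :
    ∃ w ∈ A, w ∈ X q := by
  have : q ∈ typeOf X A := by
    rw [h.type_eq]
    exact hq
  exact this

theorem IsTrimSet.eq_of_mem {p : P} {A : Set W} (h : IsTrimSet lt X p A) (hp : ¬ lt p p)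
    {v w : W} (hv : v ∈ A) (hv' : v ∈ X p) (hw : w ∈ A) (hw' : w ∈ X p) : v = w :=
  Set.encard_le_one_iff.1 (h.card_eq hp).le v w ⟨hv, hv'⟩ ⟨hw, hw'⟩

theorem IsPPartition.eq_of_mem (h : IsPPartition lt X) {p q : P} {w : W} (hp : w ∈ X p)
    (hq : w ∈ X q) : p = q := by
  by_contra hne
  exact Set.disjoint_left.1 (h.disjoint p q hne) hp hq

theorem IsPPartition.mem_derivedSet_iff (h : IsPPartition lt X) {p q : P} {w : W} (hw : w ∈ X p) :
    w ∈ derivedSet (X q) ↔ lt p q := by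
  constructor
  · intro hd
    have : w ∈ ⋃ r ∈ {r | lt r q}, X r := by
      rw [← h.derived q]
      exact ⟨hd, Set.mem_iUnion.2 ⟨p, hw⟩⟩
    simp only [Set.mem_ofPred_eq, Set.mem_iUnion] at this
    obtain ⟨r, hr, hwr⟩ := this
    rwa [h.eq_of_mem hw hwr]
  · intro hlt
    have : w ∈ derivedSet (X q) ∩ ⋃ q, X q := by
      rw [h.derived q]
      exact Set.mem_biUnion (show p ∈ {r | lt r q} from hlt) hw
    exact this.1

theorem mem_derivedSet_iff_nhds {S : Set W} {w : W} :
    w ∈ derivedSet S ↔ ∀ U ∈ 𝓝 w, ∃ v ∈ U, v ∈ S ∧ v ≠ w := by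
  rw [mem_derivedSet, accPt_iff_nhds]
  simp only [Set.mem_inter_iff, and_assoc]

/-- `P`-partitions satisfying T1 and T3. -/
structure IsPretrim (lt : P → P → Prop) (X : P → Set W) : Prop where
  isPPartition : IsPPartition lt X
  t1 : T1 lt X
  t3 : T3 lt X

theorem IsTrimPartition.isPretrim (h : IsTrimPartition lt X) : IsPretrim lt X :=
  ⟨h.isPPartition, h.t1, h.t3⟩

/-- Only the lower bound on types needs checking: a point `v` of `X p` in `A` is a limit of `X q`
for every `q > p`, so all these types occur automatically. -/
theorem IsPPartition.isTrimSet (h : IsPPartition lt X) {p : P} {A : CompactOpens W}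
    (hle : ∀ q, ∀ w ∈ A, w ∈ X q → leOf lt p q) {v : W} (hv : v ∈ A) (hvp : v ∈ X p)
    (huniq : ¬ lt p p → ∀ w ∈ A, w ∈ X p → w = v) : IsTrimSet lt X p (A : Set W) where
  isCompact := A.isCompact
  isOpen := A.isOpen
  type_eq := by
    ext q
    constructor
    · rintro ⟨w, hw, hq⟩
      exact hle q w hw hq
    · rintro (hq | rfl)
      · obtain ⟨w, hw, hwq, -⟩ := mem_derivedSet_iff_nhds.1 ((h.mem_derivedSet_iff hvp).2 hq) A
          (A.isOpen.mem_nhds hv)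
        exact ⟨w, hw, hwq⟩
      · exact ⟨v, hv, hvp⟩
  card_eq hp := by
    rw [Set.encard_eq_one]
    refine ⟨v, Set.eq_singleton_iff_unique_mem.2 ⟨⟨hv, hvp⟩, fun w hw => huniq hp w hw.1 hw.2⟩⟩

theorem IsPPartition.isTrimSet_of_le (h : IsPPartition lt X) {p : P} {A B : CompactOpens W}
    (hA : IsTrimSet lt X p (A : Set W)) (hBA : B ≤ A) {v : W} (hv : v ∈ B) (hvp : v ∈ X p) :
    IsTrimSet lt X p (B : Set W) :=
  h.isTrimSet (fun _ _ hw hq => hA.le_of_mem (hBA hw) hq) hv hvp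
    fun hp _ hw hwp => hA.eq_of_mem hp (hBA hw) hwp (hBA hv) hvp

/-- Every type in `B` is strictly above `p`, so `B` adds no forbidden type and, when `p ≮ p`, no
second point of `X p`. Trim neighbourhoods need not be small: a `q`-trim neighbourhood can be
enlarged by a remote `p`-trim set, which is why `I_w` is a lower set. -/
theorem IsPPartition.isTrimSet_sup (h : IsPPartition lt X) {p q : P} (hpq : lt p q)
    {A B : CompactOpens W} (hA : IsTrimSet lt X p (A : Set W)) (hB : IsTrimSet lt X q (B : Set W)) :
    IsTrimSet lt X p ((A ⊔ B : CompactOpens W) : Set W) := by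
  obtain ⟨v, hv, hvp⟩ := hA.exists_mem (leOf_refl p)
  refine h.isTrimSet ?_ (Or.inl hv) hvp ?_
  · rintro r w (hw | hw) hr
    · exact hA.le_of_mem hw hr
    · exact Or.inl (h.poSystem.lt_of_lt_of_le hpq (hB.le_of_mem hw hr))
  · rintro hp w (hw | hw) hwp
    · exact hA.eq_of_mem hp hw hwp hv hvp
    · exact (hp (h.poSystem.lt_of_lt_of_le hpq (hB.le_of_mem hw hwp))).elim

/-- A trim set as an element of the Boolean ring of compact open sets. -/
theorem IsTrimSet.exists_eq_coe {p : P} {A : Set W} (h : IsTrimSet lt X p A) :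
    ∃ B : CompactOpens W, (B : Set W) = A :=
  ⟨⟨⟨A, h.isCompact⟩, h.isOpen⟩, rfl⟩

theorem IsPretrim.exists_isTrimSet (h : IsPretrim lt X) {w : W} {U : Set W} (hU : U ∈ 𝓝 w) :
    ∃ p, ∃ A : CompactOpens W, IsTrimSet lt X p (A : Set W) ∧ w ∈ A ∧ (A : Set W) ⊆ U := by
  obtain ⟨p, A, hA, hw, hAU⟩ := h.t1 w U hU
  obtain ⟨B, rfl⟩ := hA.exists_eq_coe
  exact ⟨p, B, hA, hw, hAU⟩

theorem IsPretrim.exists_isTrimSet_of_mem_trimTypes (h : IsPretrim lt X) {w : W} {U : Set W}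
    (hU : U ∈ 𝓝 w) {q : P} (hq : q ∈ trimTypes lt X w) :
    ∃ p, ∃ A : CompactOpens W, leOf lt q p ∧ IsTrimSet lt X p (A : Set W) ∧ w ∈ A ∧
      (A : Set W) ⊆ U := by
  obtain ⟨B, hB, hwB⟩ := hq
  obtain ⟨p, A, hA, hwA, hAU⟩ := h.exists_isTrimSet
    (Filter.inter_mem hU (hB.isOpen.mem_nhds hwB))
  obtain ⟨v, hv, hvp⟩ := hA.exists_mem (leOf_refl p)
  exact ⟨p, A, hB.le_of_mem (hAU hv).2 hvp, hA, hwA, fun v hv => (hAU hv).1⟩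

theorem IsPretrim.exists_isTrimSet_of_mem (h : IsPretrim lt X) {p : P} {w : W} (hw : w ∈ X p)
    {U : Set W} (hU : U ∈ 𝓝 w) :
    ∃ A : CompactOpens W, IsTrimSet lt X p (A : Set W) ∧ w ∈ A ∧ (A : Set W) ⊆ U := by
  obtain ⟨q, A, hpq, hA, hwA, hAU⟩ := h.exists_isTrimSet_of_mem_trimTypes hU (h.t3 p w hw)
  obtain rfl := h.isPPartition.poSystem.le_antisymm hpq (hA.le_of_mem hwA hw)
  exact ⟨A, hA, hwA, hAU⟩

theorem IsPretrim.trimTypes_eq (h : IsPretrim lt X) {p : P} {w : W} (hw : w ∈ X p) :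
    trimTypes lt X w = principalIdeal lt p := by
  ext q
  constructor
  · rintro ⟨A, hA, hwA⟩
    exact hA.le_of_mem hwA hw
  · rintro (hq | rfl)
    · obtain ⟨A, hA, hwA⟩ := h.t3 p w hw
      obtain ⟨v, hv⟩ := h.isPPartition.nonempty q
      obtain ⟨B, hB, -⟩ := h.t3 q v hv
      obtain ⟨A, rfl⟩ := hA.exists_eq_coe
      obtain ⟨B, rfl⟩ := hB.exists_eq_coe
      exact ⟨_, h.isPPartition.isTrimSet_sup hq hB hA, Or.inr hwA⟩
    · exact h.t3 q w hw

theorem IsPretrim.isIdeal_trimTypes (h : IsPretrim lt X) (w : W) :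
    IsIdeal lt (trimTypes lt X w) where
  nonempty := by
    obtain ⟨p, A, hA, hw, -⟩ := h.exists_isTrimSet (Filter.univ_mem (f := 𝓝 w))
    exact ⟨p, A, hA, hw⟩
  lower := by
    rintro p q (hpq | rfl) hq
    · obtain ⟨A, hA, hwA⟩ := hq
      obtain ⟨v, hv⟩ := h.isPPartition.nonempty p
      obtain ⟨B, hB, -⟩ := h.t3 p v hv
      obtain ⟨A, rfl⟩ := hA.exists_eq_coe
      obtain ⟨B, rfl⟩ := hB.exists_eq_coe
      exact ⟨_, h.isPPartition.isTrimSet_sup hpq hB hA, Or.inr hwA⟩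
    · exact hq
  directed := by
    rintro p ⟨A, hA, hwA⟩ q hq
    obtain ⟨r, C, hqr, hC, hwC, hCA⟩ :=
      h.exists_isTrimSet_of_mem_trimTypes (hA.isOpen.mem_nhds hwA) hq
    obtain ⟨v, hv, hvr⟩ := hC.exists_mem (leOf_refl r)
    exact ⟨r, ⟨C, hC, hwC⟩, hA.le_of_mem (hCA hv) hvr, hqr⟩

variable [T2Space W]

/-- A point `y` of `X p` in `B` is a limit of `X q`. A small `q`-trim set around a nearby point of
`X q` can avoid both `y` and `x`, and `B \ D` stays `p`-trim because it keeps `y`. -/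
theorem IsPretrim.exists_split_notMem (h : IsPretrim lt X) {p q : P} {B : CompactOpens W}
    (hB : IsTrimSet lt X p (B : Set W)) (hpq : lt p q) (x : W) :
    ∃ D ≤ B, IsTrimSet lt X q (D : Set W) ∧ IsTrimSet lt X p ((B \ D : CompactOpens W) : Set W) ∧
      x ∉ D := by
  obtain ⟨y, hy, hyp⟩ := hB.exists_mem (leOf_refl p)
  have hyB := B.isOpen.mem_nhds hy
  obtain ⟨z, hz, hzq, hzy, hzx⟩ : ∃ z ∈ B, z ∈ X q ∧ z ≠ y ∧ z ≠ x := by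
    have hacc := mem_derivedSet_iff_nhds.1 ((h.isPPartition.mem_derivedSet_iff hyp).2 hpq)
    by_cases hxy : y = x
    · obtain ⟨z, hz, hzq, hzy⟩ := hacc _ hyB
      exact ⟨z, hz, hzq, hzy, hxy ▸ hzy⟩
    · obtain ⟨z, hz, hzq, hzy⟩ := hacc _ (Filter.inter_mem hyB
        (isOpen_compl_singleton.mem_nhds (show y ∈ {x}ᶜ from hxy)))
      exact ⟨z, hz.1, hzq, hzy, hz.2⟩
  obtain ⟨D, hD, -, hDU⟩ := h.exists_isTrimSet_of_mem hzq (Filter.inter_mem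
    (Filter.inter_mem (B.isOpen.mem_nhds hz) (isOpen_compl_singleton.mem_nhds hzy))
    (isOpen_compl_singleton.mem_nhds hzx))
  exact ⟨D, fun v hv => (hDU hv).1.1, hD, h.isPPartition.isTrimSet_of_le hB sdiff_le
    (compactOpens_mem_sdiff.2 ⟨hy, fun hyD => (hDU hyD).1.2 rfl⟩) hyp, fun hx => (hDU hx).2 rfl⟩

/-- The remainder must keep a point `y ≠ x` of `X p`. If the point found is `x` itself, then `q ∈
I_x` gives `p < q ≤ p`, so `x` is a limit of `X p` and another point exists. A small trim
neighbourhood of `x` missing `y` has type `r ≥ q`; if `r ≠ q`, joining a `q`-trim set that misses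
`y` corrects the type. -/
theorem IsPretrim.exists_split_mem (h : IsPretrim lt X) {p q : P} {B : CompactOpens W}
    (hB : IsTrimSet lt X p (B : Set W)) (hpq : lt p q) {x : W} (hx : x ∈ B)
    (hxq : q ∈ trimTypes lt X x) :
    ∃ D ≤ B, IsTrimSet lt X q (D : Set W) ∧ IsTrimSet lt X p ((B \ D : CompactOpens W) : Set W) ∧
      x ∈ D := by
  have hP := h.isPPartition
  have hxB := B.isOpen.mem_nhds hx
  obtain ⟨y, hy, hyp, hyx⟩ : ∃ y ∈ B, y ∈ X p ∧ y ≠ x := by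
    obtain ⟨y, hy, hyp⟩ := hB.exists_mem (leOf_refl p)
    by_cases hyx : y = x
    · subst hyx
      rw [h.trimTypes_eq hyp] at hxq
      exact mem_derivedSet_iff_nhds.1 ((hP.mem_derivedSet_iff hyp).2
        (hP.poSystem.lt_of_lt_of_le hpq hxq)) _ hxB
    · exact ⟨y, hy, hyp, hyx⟩
  obtain ⟨r, C, hqr, hC, hxC, hCU⟩ := h.exists_isTrimSet_of_mem_trimTypes
    (Filter.inter_mem hxB (isOpen_compl_singleton.mem_nhds hyx.symm)) hxq
  suffices hD : ∃ D ≤ B, IsTrimSet lt X q (D : Set W) ∧ y ∉ D ∧ x ∈ D by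
    obtain ⟨D, hDB, hD, hyD, hxD⟩ := hD
    exact ⟨D, hDB, hD, hP.isTrimSet_of_le hB sdiff_le (compactOpens_mem_sdiff.2 ⟨hy, hyD⟩) hyp, hxD⟩
  have hCB : C ≤ B := fun v hv => (hCU hv).1
  have hyC : y ∉ C := fun hyC => (hCU hyC).2 rfl
  rcases hqr with hqr | rfl
  · obtain ⟨D, hDB, hD, -, hyD⟩ := h.exists_split_notMem hB hpq y
    exact ⟨D ⊔ C, sup_le hDB hCB, hP.isTrimSet_sup hqr hD hC, fun hy => hy.elim hyD hyC, Or.inr hxC⟩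
  · exact ⟨C, hCB, hC, hyC, hxC⟩

/-! ### Decomposition of compact open sets into disjoint trim sets -/

/-- Finite disjoint unions of trim sets. -/
inductive IsTrimSum (lt : P → P → Prop) (X : P → Set W) : CompactOpens W → Prop
  | bot : IsTrimSum lt X ⊥
  | cons {p : P} {A B : CompactOpens W} : IsTrimSet lt X p (A : Set W) → Disjoint A B →
      IsTrimSum lt X B → IsTrimSum lt X (A ⊔ B)

theorem IsTrimSet.isTrimSum {p : P} {A : CompactOpens W} (h : IsTrimSet lt X p (A : Set W)) :
    IsTrimSum lt X A := by
  simpa using IsTrimSum.cons h disjoint_bot_right IsTrimSum.bot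

theorem IsTrimSum.sup {A B : CompactOpens W} (hA : IsTrimSum lt X A) (hB : IsTrimSum lt X B)
    (hAB : Disjoint A B) : IsTrimSum lt X (A ⊔ B) := by
  induction hA with
  | bot => simpa using hB
  | cons hA hd _ ih =>
    rw [sup_assoc]
    exact .cons hA (disjoint_sup_right.2 ⟨hd, hAB.mono_left le_sup_left⟩)
      (ih (hAB.mono_left le_sup_right))

/-- If `p < p`, then `A` is already `p`-trim and the bound is vacuous. Otherwise points of `X p` are
split off one at a time in small `p`-trim sets, leaving at least one behind so that the remainder
satisfies the same hypotheses. -/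
theorem IsPretrim.isTrimSum_of_finite (h : IsPretrim lt X) {p : P} (n : ℕ) :
    ∀ A : CompactOpens W, (∀ q, ∀ w ∈ A, w ∈ X q → leOf lt p q) → (∃ v ∈ A, v ∈ X p) →
      (¬ lt p p → ((A : Set W) ∩ X p).encard ≤ n) → IsTrimSum lt X A := by
  induction n with
  | zero =>
    rintro A hle ⟨v, hv, hvp⟩ hcard
    refine (h.isPPartition.isTrimSet hle hv hvp fun hp w hw hwp => ?_).isTrimSum
    have h0 := hcard hp
    rw [Nat.cast_zero, nonpos_iff_eq_zero, Set.encard_eq_zero] at h0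
    exact (Set.eq_empty_iff_forall_notMem.1 h0 w ⟨hw, hwp⟩).elim
  | succ n ih =>
    rintro A hle ⟨v, hv, hvp⟩ hcard
    by_cases hu : ¬ lt p p → ∀ w ∈ A, w ∈ X p → w = v
    · exact (h.isPPartition.isTrimSet hle hv hvp hu).isTrimSum
    · push Not at hu
      obtain ⟨hp, w, hw, hwp, hwv⟩ := hu
      obtain ⟨C, hC, hvC, hCU⟩ := h.exists_isTrimSet_of_mem hvp (Filter.inter_mem
        (A.isOpen.mem_nhds hv) (isOpen_compl_singleton.mem_nhds hwv.symm))
      have hCA : C ≤ A := fun u hu => (hCU hu).1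
      have hAC : IsTrimSum lt X (A \ C) := by
        refine ih (A \ C) (fun q u hu => hle q u hu.1)
          ⟨w, ⟨hw, fun hwC => (hCU hwC).2 rfl⟩, hwp⟩ fun _ => ?_
        have h1 : insert v (((A \ C : CompactOpens W) : Set W) ∩ X p) ⊆ (A : Set W) ∩ X p :=
          Set.insert_subset ⟨hv, hvp⟩ fun u hu => ⟨hu.1.1, hu.2⟩
        have h2 := (Set.encard_le_encard h1).trans (hcard hp)
        rw [Set.encard_insert_of_notMem fun hv' => hv'.1.2 hvC, Nat.cast_succ] at h2
        exact (ENat.add_le_add_iff_right ENat.one_ne_top).1 h2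
      rw [← sup_sdiff_cancel_right hCA]
      exact .cons hC disjoint_sdiff_self_right hAC

/-- Overlaps are removed by taking a set `A₀` of minimal type `p`, joining the sets of type at least
`p` to `G` and the others to `H`, and applying induction to `H`. By minimality `H` contains no point
of `X p`, so `G \ H` keeps the point of `A₀`. If `p ≮ p`, each set of the family has at most one
point in `X p`, so the previous lemma applies to `G \ H`. -/
theorem IsPretrim.isTrimSum_finset_sup (h : IsPretrim lt X) (s : Finset (CompactOpens W)) :
    (∀ A ∈ s, ∃ p, IsTrimSet lt X p (A : Set W)) → IsTrimSum lt X (s.sup id) := by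
  classical
  induction s using Finset.strongInduction with
  | H s ih =>
    intro hs
    rcases s.eq_empty_or_nonempty with rfl | hne
    · simpa using IsTrimSum.bot
    have hPO := h.isPPartition.poSystem
    have : Nonempty P := hne.elim fun A hA => (hs A hA).nonempty
    choose! t ht using hs
    let _ : PartialOrder P :=
      { le := leOf lt
        le_refl := leOf_refl
        le_trans := fun _ _ _ => hPO.le_trans
        le_antisymm := fun _ _ => hPO.le_antisymm }
    obtain ⟨A₀, hA₀, hmin⟩ := s.exists_minimalFor t hne
    set p := t A₀
    set G := (s.filter fun A => leOf lt p (t A)).sup id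
    set H := (s.filter fun A => ¬ leOf lt p (t A)).sup id
    have hmem := compactOpens_mem_finset_sup (W := W)
    have hsup : s.sup id = H ⊔ G \ H := by
      rw [sup_sdiff_self_right, sup_comm, ← Finset.sup_union, Finset.filter_union_filter_not_eq]
    have hH : IsTrimSum lt X H := by
      refine ih _ ?_ fun A hA => ⟨t A, ht A (Finset.mem_filter.1 hA).1⟩
      exact Finset.filter_ssubset.2 ⟨A₀, hA₀, by simpa using leOf_refl p⟩
    obtain ⟨v, hv, hvp⟩ := (ht A₀ hA₀).exists_mem (leOf_refl p)
    have hG : IsTrimSum lt X (G \ H) := by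
      have hGp : ∀ q, ∀ w ∈ G \ H, w ∈ X q → leOf lt p q := by
        rintro q w ⟨hw, -⟩ hq
        obtain ⟨A, hA, hwA⟩ := (hmem _ w).1 hw
        rw [Finset.mem_filter] at hA
        exact hPO.le_trans hA.2 ((ht A hA.1).le_of_mem hwA hq)
      have hvG : ∃ v ∈ G \ H, v ∈ X p := by
        refine ⟨v, ⟨(hmem _ v).2 ⟨A₀, Finset.mem_filter.2 ⟨hA₀, leOf_refl p⟩, hv⟩, fun hvH => ?_⟩,
          hvp⟩
        obtain ⟨A, hA, hvA⟩ := (hmem _ v).1 hvH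
        rw [Finset.mem_filter] at hA
        exact hA.2 (hmin hA.1 ((ht A hA.1).le_of_mem hvA hvp))
      have hfin : ¬ lt p p → (((G \ H : CompactOpens W) : Set W) ∩ X p).Finite := by
        intro hp
        refine Set.Finite.subset (s.finite_toSet.biUnion (t := fun A => (A : Set W) ∩ X p)
          fun A hA => ?_) ?_
        · refine Set.Subsingleton.finite fun u hu w hw => ?_
          have hAp : t A = p := by
            have h1 := (ht A hA).le_of_mem hu.1 hu.2
            exact hPO.le_antisymm h1 (hmin hA h1)
          have hA' := ht A hA
          rw [hAp] at hA'
          exact hA'.eq_of_mem hp hu.1 hu.2 hw.1 hw.2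
        · rintro w ⟨⟨hw, -⟩, hwp⟩
          obtain ⟨A, hA, hwA⟩ := (hmem _ w).1 hw
          exact Set.mem_biUnion (Finset.mem_coe.2 (Finset.mem_filter.1 hA).1) ⟨hwA, hwp⟩
      by_cases hp : lt p p
      · exact h.isTrimSum_of_finite 0 _ hGp hvG fun hp' => (hp' hp).elim
      · refine h.isTrimSum_of_finite (hfin hp).toFinset.card _ hGp hvG fun _ => ?_
        rw [(hfin hp).encard_eq_coe_toFinset_card]
    rw [hsup]
    exact hH.sup hG disjoint_sdiff_self_right

theorem IsPretrim.isTrimSum (h : IsPretrim lt X) (A : CompactOpens W) : IsTrimSum lt X A := by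
  classical
  have hcov : ∀ w : W, ∃ B : CompactOpens W, w ∈ A → (∃ p, IsTrimSet lt X p (B : Set W)) ∧ w ∈ B ∧
      (B : Set W) ⊆ A := by
    intro w
    by_cases hw : w ∈ A
    · obtain ⟨p, B, hB, hwB, hBA⟩ := h.exists_isTrimSet (A.isOpen.mem_nhds hw)
      exact ⟨B, fun _ => ⟨⟨p, hB⟩, hwB, hBA⟩⟩
    · exact ⟨⊥, fun h => (hw h).elim⟩
  choose B hB using hcov
  obtain ⟨t, htA, ht⟩ := A.isCompact.elim_nhds_subcover (fun w => (B w : Set W))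
    fun w hw => (B w).isOpen.mem_nhds (hB w hw).2.1
  have hsup : (t.image B).sup id = A := by
    refine le_antisymm (Finset.sup_le fun C hC => ?_) fun w hw => ?_
    · obtain ⟨w, hw, rfl⟩ := Finset.mem_image.1 hC
      exact (hB w (htA w hw)).2.2
    · obtain ⟨v, hv, hwv⟩ := Set.mem_iUnion₂.1 (ht hw)
      have : B v ≤ (t.image B).sup id :=
        Finset.le_sup (f := id) (Finset.mem_image_of_mem B hv)
      exact this hwv
  rw [← hsup]
  refine h.isTrimSum_finset_sup _ fun C hC => ?_
  obtain ⟨w, hw, rfl⟩ := Finset.mem_image.1 hC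
  exact (hB w (htA w hw)).1

/-! ### The back-and-forth relation with a marked point on each side -/

/-- Finite disjoint unions of corresponding trim sets of equal types, in which the points `w` and
`x` lie in corresponding pieces. -/
inductive TrimRel (lt : P → P → Prop) (X : P → Set W) (w x : W) :
    CompactOpens W → CompactOpens W → Prop
  | bot : TrimRel lt X w x ⊥ ⊥
  | cons {p : P} {A B A' B' : CompactOpens W} : IsTrimSet lt X p (A : Set W) →
      IsTrimSet lt X p (B : Set W) → (w ∈ A ↔ x ∈ B) → Disjoint A A' → Disjoint B B' →
      TrimRel lt X w x A' B' → TrimRel lt X w x (A ⊔ A') (B ⊔ B')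

variable {w x : W}

theorem TrimRel.of_isTrimSet {p : P} {A B : CompactOpens W} (hA : IsTrimSet lt X p (A : Set W))
    (hB : IsTrimSet lt X p (B : Set W)) (h : w ∈ A ↔ x ∈ B) : TrimRel lt X w x A B := by
  simpa using TrimRel.cons hA hB h disjoint_bot_right disjoint_bot_right TrimRel.bot

theorem TrimRel.symm {A B : CompactOpens W} (h : TrimRel lt X w x A B) : TrimRel lt X x w B A := by
  induction h with
  | bot => exact .bot
  | cons h₁ h₂ h₃ h₄ h₅ _ ih => exact .cons h₂ h₁ h₃.symm h₅ h₄ ih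

theorem TrimRel.mem_iff {A B : CompactOpens W} (h : TrimRel lt X w x A B) : w ∈ A ↔ x ∈ B := by
  induction h with
  | bot => exact Iff.rfl
  | cons _ _ h _ _ _ ih => exact or_congr h ih

theorem TrimRel.sup {A B A' B' : CompactOpens W} (h : TrimRel lt X w x A B)
    (h' : TrimRel lt X w x A' B') (hA : Disjoint A A') (hB : Disjoint B B') :
    TrimRel lt X w x (A ⊔ A') (B ⊔ B') := by
  induction h with
  | bot => simpa using h'
  | cons h₁ h₂ h₃ h₄ h₅ _ ih =>
    rw [sup_assoc, sup_assoc]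
    exact .cons h₁ h₂ h₃ (disjoint_sup_right.2 ⟨h₄, hA.mono_left le_sup_left⟩)
      (disjoint_sup_right.2 ⟨h₅, hB.mono_left le_sup_left⟩)
      (ih (hA.mono_left le_sup_right) (hB.mono_left le_sup_right))

theorem TrimRel.eq_bot {A B : CompactOpens W} (h : TrimRel lt X w x A B) (hA : A = ⊥) :
    B = ⊥ := by
  induction h with
  | bot => rfl
  | @cons p A B A' B' h₁ _ _ _ _ _ _ =>
    obtain ⟨v, hv, -⟩ := h₁.exists_mem (leOf_refl p)
    exact (compactOpens_ne_bot_iff.2 ⟨v, Or.inl hv⟩ hA).elim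

/-- All pieces of `S` have types strictly above `p`, so copies can be cut from `B` one after another
while the remainder stays `p`-trim. The piece containing `w`, if any, is copied around `x`, which is
possible because `I_w = I_x`; the other copies avoid `x`. -/
theorem IsPretrim.exists_trimRel_of_isTrimSum (h : IsPretrim lt X)
    (hwx : trimTypes lt X w = trimTypes lt X x) {p : P} {S : CompactOpens W}
    (hS : IsTrimSum lt X S) : ∀ B : CompactOpens W, IsTrimSet lt X p (B : Set W) →
      (∀ q, ∀ v ∈ S, v ∈ X q → lt p q) → (w ∈ S → x ∈ B) →
      ∃ D ≤ B, TrimRel lt X w x S D ∧ IsTrimSet lt X p ((B \ D : CompactOpens W) : Set W) := by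
  induction hS with
  | bot =>
    intro B hB _ _
    exact ⟨⊥, bot_le, .bot, by simpa using hB⟩
  | @cons q A S hA hd _ ih =>
    intro B hB hlt hmark
    obtain ⟨v, hv, hvq⟩ := hA.exists_mem (leOf_refl q)
    have hpq : lt p q := hlt q v (Or.inl hv) hvq
    obtain ⟨D, hDB, hD, hBD, hwD⟩ : ∃ D ≤ B, IsTrimSet lt X q (D : Set W) ∧
        IsTrimSet lt X p ((B \ D : CompactOpens W) : Set W) ∧ (w ∈ A ↔ x ∈ D) := by
      by_cases hwA : w ∈ A
      · obtain ⟨D, h1, h2, h3, h4⟩ := h.exists_split_mem hB hpq (hmark (Or.inl hwA))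
          (by rw [← hwx]; exact ⟨A, hA, hwA⟩)
        exact ⟨D, h1, h2, h3, iff_of_true hwA h4⟩
      · obtain ⟨D, h1, h2, h3, h4⟩ := h.exists_split_notMem hB hpq x
        exact ⟨D, h1, h2, h3, iff_of_false hwA h4⟩
    obtain ⟨E, hEB, hE, hBE⟩ := ih (B \ D) hBD (fun r v hv => hlt r v (Or.inr hv))
      fun hwS => ⟨hmark (Or.inr hwS), fun hxD =>
        compactOpens_disjoint_iff.1 hd w (hwD.2 hxD) hwS⟩
    refine ⟨D ⊔ E, sup_le hDB (hEB.trans sdiff_le),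
      .cons hA hD hwD hd (disjoint_sdiff_self_right.mono_right hEB) hE, ?_⟩
    rwa [← sdiff_sdiff]

/-- Since `C` keeps the point `v` of `X p`, all types in `A \ C` are strictly above `p`: type `p`
itself can recur only if `p < p`. So `A \ C` can be copied inside `B`, and both `C` and what is left
of `B` are `p`-trim. -/
theorem IsPretrim.exists_trimRel_sdiff (h : IsPretrim lt X)
    (hwx : trimTypes lt X w = trimTypes lt X x) {p : P} {A B C : CompactOpens W}
    (hA : IsTrimSet lt X p (A : Set W)) (hB : IsTrimSet lt X p (B : Set W)) (hAB : w ∈ A ↔ x ∈ B)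
    (hCA : C ≤ A) {v : W} (hv : v ∈ C) (hvp : v ∈ X p) :
    ∃ D ≤ B, TrimRel lt X w x (A \ C) D ∧ TrimRel lt X w x C (B \ D) := by
  obtain ⟨D, hDB, hD, hBD⟩ := h.exists_trimRel_of_isTrimSum hwx (h.isTrimSum (A \ C)) B hB
    (fun q u hu huq => by
      rcases hA.le_of_mem hu.1 huq with hq | rfl
      · exact hq
      · by_contra hp
        rw [hA.eq_of_mem hp hu.1 huq (hCA hv) hvp] at hu
        exact hu.2 hv) fun hw => hAB.1 hw.1
  refine ⟨D, hDB, hD, .of_isTrimSet (h.isPPartition.isTrimSet_of_le hA hCA hv hvp) hBD ?_⟩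
  have h1 : (w ∈ A ∧ w ∉ C) ↔ x ∈ D := hD.mem_iff
  have h2 : w ∈ C → w ∈ A := fun h => hCA h
  rw [compactOpens_mem_sdiff]
  tauto

theorem IsPretrim.exists_trimRel_split (h : IsPretrim lt X)
    (hwx : trimTypes lt X w = trimTypes lt X x) {A B : CompactOpens W}
    (hAB : TrimRel lt X w x A B) : ∀ C ≤ A, ∃ D ≤ B, TrimRel lt X w x C D ∧
      TrimRel lt X w x (A \ C) (B \ D) := by
  induction hAB with
  | bot =>
    intro C hC
    obtain rfl := le_bot_iff.1 hC
    exact ⟨⊥, le_rfl, .bot, by simpa using TrimRel.bot⟩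
  | @cons p A B A' B' hA hB hAB hAA' hBB' _ ih =>
    intro C hC
    obtain ⟨D', hD', h1, h2⟩ := ih (C ⊓ A') inf_le_right
    obtain ⟨D, hD, h3, h4⟩ : ∃ D ≤ B, TrimRel lt X w x (C ⊓ A) D ∧
        TrimRel lt X w x (A \ (C ⊓ A)) (B \ D) := by
      obtain ⟨v, hv, hvp⟩ := hA.exists_mem (leOf_refl p)
      -- Whichever of `C ⊓ A` and its complement in `A` contains `v` is the `p`-trim half; the other
      -- half is copied into `B`.
      by_cases hvC : v ∈ C
      · obtain ⟨D, hD, h3, h4⟩ := h.exists_trimRel_sdiff hwx hA hB hAB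
          (inf_le_right : C ⊓ A ≤ A) ⟨hvC, hv⟩ hvp
        exact ⟨B \ D, sdiff_le, h4, by rwa [sdiff_sdiff_eq_self hD]⟩
      · obtain ⟨D, hD, h3, h4⟩ := h.exists_trimRel_sdiff hwx hA hB hAB
          (sdiff_le : A \ (C ⊓ A) ≤ A) ⟨hv, fun h => hvC h.1⟩ hvp
        exact ⟨D, hD, by rwa [sdiff_sdiff_eq_self inf_le_right] at h3, h4⟩
    refine ⟨D ⊔ D', sup_le_sup hD hD', ?_, ?_⟩
    · have : C = C ⊓ A ⊔ C ⊓ A' := by rw [← inf_sup_left, inf_eq_left.2 hC]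
      rw [this]
      exact h3.sup h1 (hAA'.mono inf_le_right inf_le_right) (hBB'.mono hD hD')
    · have e1 : (A ⊔ A') \ C = A \ (C ⊓ A) ⊔ A' \ (C ⊓ A') := by
        rw [sup_sdiff, sdiff_inf_self_right, sdiff_inf_self_right]
      have e2 : (B ⊔ B') \ (D ⊔ D') = B \ D ⊔ B' \ D' := by
        rw [compactOpens_disjoint_iff] at hBB'
        refine compactOpens_ext fun u => ?_
        have a1 := hBB' u
        have a2 := @hD u
        have a3 := @hD' u
        simp only [compactOpens_mem_sdiff, compactOpens_mem_sup]
        tauto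
      rw [e1, e2]
      exact h4.sup h2 (hAA'.mono sdiff_le sdiff_le) (hBB'.mono sdiff_le sdiff_le)

theorem IsPretrim.isVaughtRelation (h : IsPretrim lt X)
    (hwx : trimTypes lt X w = trimTypes lt X x) : IsVaughtRelation (TrimRel lt X w x) where
  bot := .bot
  eq_bot_iff _ _ hAB := ⟨hAB.eq_bot, hAB.symm.eq_bot⟩
  sup _ _ _ _ h₁ h₂ h₃ h₄ := h₁.sup h₂ h₃ h₄
  split_left _ _ hAB := h.exists_trimRel_split hwx hAB
  split_right _ _ hAB D hD := by
    obtain ⟨C, hC, h1, h2⟩ := h.exists_trimRel_split hwx.symm hAB.symm D hD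
    exact ⟨C, hC, h1.symm, h2.symm⟩

variable [Countable (CompactOpens W)]

theorem IsPretrim.exists_orderIso (h : IsPretrim lt X)
    (hwx : trimTypes lt X w = trimTypes lt X x) {p : P} {A B : CompactOpens W}
    (hA : IsTrimSet lt X p (A : Set W)) (hB : IsTrimSet lt X p (B : Set W)) (hw : w ∈ A)
    (hx : x ∈ B) : ∃ f : Set.Iic A ≃o Set.Iic B, ∀ C : Set.Iic A, w ∈ C.1 ↔ x ∈ (f C).1 := by
  obtain ⟨f, hf⟩ := (h.isVaughtRelation hwx).exists_orderIso
    (TrimRel.of_isTrimSet hA hB (iff_of_true hw hx))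
  exact ⟨f, fun C => (hf C).mem_iff⟩

/-- Trim sets of equal types are isomorphic. -/
theorem IsPretrim.idealIso (h : IsPretrim lt X) {p : P} {A B : CompactOpens W}
    (hA : IsTrimSet lt X p (A : Set W)) (hB : IsTrimSet lt X p (B : Set W)) : IdealIso A B := by
  obtain ⟨w, hw, hwp⟩ := hA.exists_mem (leOf_refl p)
  obtain ⟨x, hx, hxp⟩ := hB.exists_mem (leOf_refl p)
  obtain ⟨f, -⟩ := h.exists_orderIso ((h.trimTypes_eq hwp).trans (h.trimTypes_eq hxp).symm)
    hA hB hw hx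
  exact ⟨f⟩

/-- Points whose trim neighbourhoods have the same types lie in the same orbit. -/
theorem IsPretrim.exists_homeomorph [LocallyCompactSpace W] [TotallyDisconnectedSpace W]
    (h : IsPretrim lt X) (hwx : trimTypes lt X w = trimTypes lt X x) :
    ∃ g : W ≃ₜ W, g w = x := by
  by_cases hne : w = x
  · exact ⟨Homeomorph.refl W, hne⟩
  obtain ⟨U, V, hU, hV, hwU, hxV, hUV⟩ := t2_separation hne
  obtain ⟨p, A, hA, hwA, hAU⟩ := h.exists_isTrimSet (hU.mem_nhds hwU)
  obtain ⟨r, C, hpr, hC, hxC, hCV⟩ := h.exists_isTrimSet_of_mem_trimTypes (hV.mem_nhds hxV)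
    (hwx ▸ ⟨A, hA, hwA⟩ : p ∈ trimTypes lt X x)
  -- The types of the neighbourhoods `A` and `C` satisfy only `p ≤ r`. Cutting an `r`-trim set
  -- around `w` out of `A` equalizes them while keeping the two sets disjoint.
  obtain ⟨D, hDA, hD, hwD⟩ : ∃ D ≤ A, IsTrimSet lt X r (D : Set W) ∧ w ∈ D := by
    rcases hpr with hpr | rfl
    · obtain ⟨D, h1, h2, -, h3⟩ := h.exists_split_mem hA hpr hwA (hwx ▸ ⟨C, hC, hxC⟩)
      exact ⟨D, h1, h2, h3⟩
    · exact ⟨A, le_rfl, hA, hwA⟩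
  obtain ⟨f, hf⟩ := h.exists_orderIso hwx hD hC hwD hxC
  refine exists_homeomorph_apply_eq ?_ f hwD hf
  exact compactOpens_disjoint_iff.2 fun v hv hvC =>
    Set.disjoint_left.1 hUV (hAU (hDA hv)) (hCV hvC)

end Trim

/-! ### Realizing ideals by points, and the ideal completion of a trim partition -/

section IdealCompletion

set_option linter.unusedSectionVars false

variable {P : Type*} {lt : P → P → Prop}

theorem IsPOSystem.isIdeal_principalIdeal (h : IsPOSystem lt) (p : P) :
    IsIdeal lt (principalIdeal lt p) where
  nonempty := ⟨p, leOf_refl p⟩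
  lower _ _ hqr hr := h.le_trans hqr hr
  directed _ hx _ hy := ⟨p, leOf_refl p, hx, hy⟩

/-- The principal ideal generated by `p`, as an element of the ideal completion. -/
def IsPOSystem.principal (h : IsPOSystem lt) (p : P) : IdealCompletion lt :=
  ⟨principalIdeal lt p, h.isIdeal_principalIdeal p⟩

theorem IsPOSystem.principalIdeal_injective (h : IsPOSystem lt) :
    Function.Injective (principalIdeal lt) := by
  intro p q hpq
  have h1 : p ∈ principalIdeal lt q := hpq ▸ leOf_refl p
  have h2 : q ∈ principalIdeal lt p := hpq ▸ leOf_refl q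
  exact h.le_antisymm h1 h2

theorem IsIdeal.principalIdeal_subset_iff {J : Set P} (hJ : IsIdeal lt J) {p : P} :
    principalIdeal lt p ⊆ J ↔ p ∈ J :=
  ⟨fun h => h (leOf_refl p), fun hp q hq => hJ.lower q p hq hp⟩

theorem idLT_principal_self_iff (h : IsPOSystem lt) (p : P) :
    idLT lt (h.principal p) (h.principal p) ↔ lt p p := by
  constructor
  · rintro (h1 | ⟨-, h1⟩)
    · exact (h1.2 h1.1).elim
    · by_contra hp
      exact h1 ⟨p, hp, rfl⟩
  · intro hp
    refine Or.inr ⟨rfl, ?_⟩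
    rintro ⟨q, hq, hpq⟩
    rw [← h.principalIdeal_injective hpq] at hq
    exact hq hp

theorem leOf_idLT_iff {J K : IdealCompletion lt} : leOf (idLT lt) J K ↔ J.1 ⊆ K.1 := by
  constructor
  · rintro ((h | ⟨rfl, -⟩) | rfl)
    · exact h.1
    · exact subset_rfl
    · exact subset_rfl
  · intro h
    by_cases hJK : J = K
    · exact Or.inr hJK
    · exact Or.inl (Or.inl (h.ssubset_of_ne fun h => hJK (Subtype.ext h)))

theorem isPOSystem_idLT (lt : P → P → Prop) : IsPOSystem (idLT lt) where
  trans := by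
    rintro J K L (h | ⟨rfl, h⟩) hKL
    · exact Or.inl (h.trans_subset (leOf_idLT_iff.1 (Or.inl hKL)))
    · exact hKL
  antisymm J K h h' := Subtype.ext
    ((leOf_idLT_iff.1 (Or.inl h)).antisymm (leOf_idLT_iff.1 (Or.inl h')))

variable {W : Type*} [TopologicalSpace W] {X : P → Set W}

theorem IsPretrim.countable [Countable (CompactOpens W)] (h : IsPretrim lt X) : Countable P := by
  have hex : ∀ p, ∃ A : CompactOpens W, IsTrimSet lt X p (A : Set W) := by
    intro p
    obtain ⟨w, hw⟩ := h.isPPartition.nonempty p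
    obtain ⟨A, hA, -⟩ := h.t3 p w hw
    obtain ⟨A, rfl⟩ := hA.exists_eq_coe
    exact ⟨A, hA⟩
  choose A hA using hex
  refine Function.Injective.countable (f := A) fun p q hpq => ?_
  have hq := hA q
  rw [← hpq] at hq
  obtain ⟨v, hv, hvp⟩ := (hA p).exists_mem (leOf_refl p)
  obtain ⟨w, hw, hwq⟩ := hq.exists_mem (leOf_refl q)
  exact h.isPPartition.poSystem.le_antisymm ((hA p).le_of_mem hw hwq) (hq.le_of_mem hv hvp)

/-- The ideal `I_w`, as an element of the ideal completion. -/
def IsPretrim.ideal (h : IsPretrim lt X) (w : W) : IdealCompletion lt :=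
  ⟨trimTypes lt X w, h.isIdeal_trimTypes w⟩

variable [T2Space W] [Countable (CompactOpens W)]

/-- Every trim set of type in the ideal `J` contains a point with ideal `J`. -/
theorem IsPretrim.exists_trimTypes_eq (h : IsPretrim lt X) {J : Set P} (hJ : IsIdeal lt J) {q : P}
    (hq : q ∈ J) {B : CompactOpens W} (hB : IsTrimSet lt X q (B : Set W)) :
    ∃ y ∈ B, trimTypes lt X y = J := by
  have hPO := h.isPPartition.poSystem
  have := h.countable
  have : Nonempty P := ⟨q⟩
  obtain ⟨e, he⟩ := exists_surjective_nat P
  obtain ⟨C, hC⟩ := exists_surjective_nat (CompactOpens W)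
  let T := {s : P × CompactOpens W // s.1 ∈ J ∧ IsTrimSet lt X s.1 (s.2 : Set W)}
  -- Types stay in `J`. Stage `n` raises the type above `e n` when `e n ∈ J`, so that `J ⊆ I_y` in
  -- the limit, and decides `C n`. If `C n` is an `r`-trim neighbourhood of the limit point, the
  -- next stage lies inside it, which forces `r ∈ J`.
  have step : ∀ (n : ℕ) (s : T), ∃ s' : T, s'.1.2 ≤ s.1.2 ∧ (e n ∈ J → leOf lt (e n) s'.1.1) ∧
      (s'.1.2 ≤ C n ∨ Disjoint s'.1.2 (C n)) := by
    rintro n ⟨⟨p, A⟩, hp, hA⟩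
    obtain ⟨r, hrJ, hpr, hr⟩ : ∃ r ∈ J, leOf lt p r ∧ (e n ∈ J → leOf lt (e n) r) := by
      by_cases hn : e n ∈ J
      · obtain ⟨r, hr, h1, h2⟩ := hJ.directed p hp (e n) hn
        exact ⟨r, hr, h1, fun _ => h2⟩
      · exact ⟨p, hp, leOf_refl p, fun h => (hn h).elim⟩
    obtain ⟨y, hy, hyr⟩ := hA.exists_mem hpr
    by_cases hyC : y ∈ C n
    · obtain ⟨D, hD, -, hDU⟩ := h.exists_isTrimSet_of_mem hyr
        (Filter.inter_mem (A.isOpen.mem_nhds hy) ((C n).isOpen.mem_nhds hyC))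
      exact ⟨⟨(r, D), hrJ, hD⟩, fun v hv => (hDU hv).1, hr, Or.inl fun v hv => (hDU hv).2⟩
    · obtain ⟨D, hD, -, hDU⟩ := h.exists_isTrimSet_of_mem hyr
        (Filter.inter_mem (A.isOpen.mem_nhds hy)
          ((C n).isCompact.isClosed.isOpen_compl.mem_nhds hyC))
      exact ⟨⟨(r, D), hrJ, hD⟩, fun v hv => (hDU hv).1, hr,
        Or.inr (compactOpens_disjoint_iff.2 fun v hv => (hDU hv).2)⟩
  choose next hle hcof hdec using step
  let S : ℕ → T := fun n => Nat.rec ⟨(q, B), hq, hB⟩ next n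
  have hS : ∀ n, S (n + 1) = next n (S n) := fun n => rfl
  obtain ⟨y, hy⟩ : (⋂ n, ((S n).1.2 : Set W)).Nonempty := by
    refine IsCompact.nonempty_iInter_of_sequence_nonempty_isCompact_isClosed _ (fun n => ?_)
      (fun n => ?_) (S 0).1.2.isCompact fun n => (S n).1.2.isCompact.isClosed
    · rw [hS]
      exact hle n (S n)
    · obtain ⟨v, hv, -⟩ := (S n).2.2.exists_mem (leOf_refl _)
      exact ⟨v, hv⟩
  rw [Set.mem_iInter] at hy
  refine ⟨y, hy 0, Set.ext fun r => ⟨?_, fun hr => ?_⟩⟩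
  · rintro ⟨D, hD, hyD⟩
    obtain ⟨D, rfl⟩ := hD.exists_eq_coe
    obtain ⟨n, rfl⟩ := hC D
    have hDn : (S (n + 1)).1.2 ≤ C n := by
      rcases hdec n (S n) with h1 | h1
      · exact h1
      · exact (compactOpens_disjoint_iff.1 h1 y (hy (n + 1)) hyD).elim
    obtain ⟨v, hv, hvp⟩ := (S (n + 1)).2.2.exists_mem (leOf_refl _)
    exact hJ.lower _ _ (hD.le_of_mem (hDn hv) hvp) (S (n + 1)).2.1
  · obtain ⟨n, rfl⟩ := he r
    exact (h.isIdeal_trimTypes y).lower _ _ (hcof n (S n) hr)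
      ⟨_, (S (n + 1)).2.2, hy (n + 1)⟩

theorem IsPretrim.idPartition_nonempty (h : IsPretrim lt X) (J : IdealCompletion lt) :
    (idPartition lt X J).Nonempty := by
  obtain ⟨q, hq⟩ := J.2.nonempty
  obtain ⟨w, hw⟩ := h.isPPartition.nonempty q
  obtain ⟨A, hA, -⟩ := h.t3 q w hw
  obtain ⟨A, rfl⟩ := hA.exists_eq_coe
  obtain ⟨y, -, hy⟩ := h.exists_trimTypes_eq J.2 hq hA
  exact ⟨y, hy⟩

theorem IsPretrim.iUnion_idPartition (h : IsPretrim lt X) :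
    (⋃ J, idPartition lt X J) = Set.univ :=
  Set.eq_univ_of_forall fun w => Set.mem_iUnion.2 ⟨h.ideal w, rfl⟩

/-- If `I_w` is the principal ideal of `p`, small trim neighbourhoods of `w` have type at least `p`,
and at most `p` because the type lies in `I_w`. So `w` has a base of `p`-trim sets, and T2 places it
in `X p`. -/
theorem IsTrimPartition.mem_iff_trimTypes_eq (h : IsTrimPartition lt X) {p : P} {w : W} :
    w ∈ X p ↔ trimTypes lt X w = principalIdeal lt p := by
  refine ⟨fun hw => h.isPretrim.trimTypes_eq hw, fun hw => ?_⟩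
  have hp : p ∈ trimTypes lt X w := by
    rw [hw]
    exact leOf_refl p
  refine h.t2 p (hp.imp fun A hA => hA.1) w fun U hU => ?_
  obtain ⟨r, A, hpr, hA, hwA, hAU⟩ := h.isPretrim.exists_isTrimSet_of_mem_trimTypes hU hp
  have hr : r ∈ principalIdeal lt p := by
    rw [← hw]
    exact ⟨A, hA, hwA⟩
  rw [h.isPPartition.poSystem.le_antisymm hpr hr]
  exact ⟨A, hA, hwA, hAU⟩

/-- A trim neighbourhood of `w` is one of all nearby points, so limits satisfy `I_w ⊆ J`.
Conversely, every trim neighbourhood of `w` with type in `J` contains a point with ideal `J`. When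
`I_w = J`, a second such point is needed: it is absent if `J` is principal at some `p ≮ p`, since a
`p`-trim set meets `X p` once. Otherwise each trim neighbourhood has a point of its own type other
than `w`, around which a trim set avoiding `w` can be used. -/
theorem IsTrimPartition.mem_derivedSet_idPartition_iff (h : IsTrimPartition lt X) {w : W}
    {J : IdealCompletion lt} :
    w ∈ derivedSet (idPartition lt X J) ↔ idLT lt (h.isPretrim.ideal w) J := by
  have hP := h.isPPartition
  have hpre := h.isPretrim
  rw [mem_derivedSet_iff_nhds]
  constructor
  · intro hd
    have hsub : trimTypes lt X w ⊆ J.1 := by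
      rintro p ⟨A, hA, hwA⟩
      obtain ⟨v, hvA, hv, -⟩ := hd A (hA.isOpen.mem_nhds hwA)
      rw [← show trimTypes lt X v = J.1 from hv]
      exact ⟨A, hA, hvA⟩
    rcases leOf_idLT_iff.2 (show (hpre.ideal w).1 ⊆ J.1 from hsub) with hlt | heq
    · exact hlt
    · refine Or.inr ⟨heq, ?_⟩
      rintro ⟨p, hp, hwp⟩
      have hw : w ∈ X p := h.mem_iff_trimTypes_eq.2 hwp
      obtain ⟨A, hA, hwA⟩ := h.t3 p w hw
      obtain ⟨v, hvA, hv, hvw⟩ := hd A (hA.isOpen.mem_nhds hwA)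
      have hvp : v ∈ X p := by
        refine h.mem_iff_trimTypes_eq.2 ?_
        rw [← hwp, heq]
        exact hv
      exact hvw (hA.eq_of_mem hp hvA hvp hwA hw)
  · intro hlt U hU
    obtain ⟨q, A, hA, hwA, hAU⟩ := hpre.exists_isTrimSet hU
    have hsub : trimTypes lt X w ⊆ J.1 := leOf_idLT_iff.1 (Or.inl hlt)
    have hqJ : q ∈ J.1 := hsub ⟨A, hA, hwA⟩
    rcases hlt with hlt | ⟨heq, hnp⟩
    · obtain ⟨v, hvA, hv⟩ := hpre.exists_trimTypes_eq J.2 hqJ hA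
      refine ⟨v, hAU hvA, hv, ?_⟩
      rintro rfl
      exact hlt.ne hv
    · obtain ⟨z, hzA, hzq, hzw⟩ : ∃ z ∈ A, z ∈ X q ∧ z ≠ w := by
        obtain ⟨z, hzA, hzq⟩ := hA.exists_mem (leOf_refl q)
        by_cases hzw : z = w
        · subst hzw
          have hqq : lt q q := by
            by_contra hqq
            exact hnp ⟨q, hqq, hpre.trimTypes_eq hzq⟩
          exact mem_derivedSet_iff_nhds.1 ((hP.mem_derivedSet_iff hzq).2 hqq) A
            (A.isOpen.mem_nhds hwA)
        · exact ⟨z, hzA, hzq, hzw⟩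
      obtain ⟨B, hB, -, hBU⟩ := hpre.exists_isTrimSet_of_mem hzq
        (Filter.inter_mem (A.isOpen.mem_nhds hzA) (isOpen_compl_singleton.mem_nhds hzw))
      obtain ⟨v, hvB, hv⟩ := hpre.exists_trimTypes_eq J.2 hqJ hB
      exact ⟨v, hAU (hBU hvB).1, hv, (hBU hvB).2⟩

/-- The ideal completion of a trim partition is a complete partition. -/
theorem IsTrimPartition.isPPartition_idPartition (h : IsTrimPartition lt X) :
    IsPPartition (idLT lt) (idPartition lt X) where
  poSystem := isPOSystem_idLT lt
  nonempty := h.isPretrim.idPartition_nonempty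
  disjoint J K hJK := Set.disjoint_left.2 fun w hJ hK =>
    hJK (Subtype.ext ((show trimTypes lt X w = J.1 from hJ).symm.trans hK))
  derived J := by
    rw [h.isPretrim.iUnion_idPartition, Set.inter_univ]
    ext w
    rw [h.mem_derivedSet_idPartition_iff]
    simp only [Set.mem_iUnion, exists_prop]
    refine ⟨fun hw => ⟨_, hw, rfl⟩, ?_⟩
    rintro ⟨K, hK, hw⟩
    rwa [show h.isPretrim.ideal w = K from Subtype.ext hw]

theorem IsTrimPartition.isTrimSet_idPartition (h : IsTrimPartition lt X) {p : P}
    {A : CompactOpens W} (hA : IsTrimSet lt X p (A : Set W)) :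
    IsTrimSet (idLT lt) (idPartition lt X) (h.isPPartition.poSystem.principal p) (A : Set W) := by
  obtain ⟨v, hv, hvp⟩ := hA.exists_mem (leOf_refl p)
  refine h.isPPartition_idPartition.isTrimSet ?_ hv (h.mem_iff_trimTypes_eq.1 hvp) ?_
  · intro J w hw hJ
    rw [leOf_idLT_iff]
    refine J.2.principalIdeal_subset_iff.2 ?_
    rw [← show trimTypes lt X w = J.1 from hJ]
    exact ⟨A, hA, hw⟩
  · intro hp w hw hwp
    rw [idLT_principal_self_iff] at hp
    exact hA.eq_of_mem hp hw (h.mem_iff_trimTypes_eq.2 hwp) hv hvp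

theorem IsTrimPartition.t1_idPartition (h : IsTrimPartition lt X) :
    T1 (idLT lt) (idPartition lt X) := by
  intro w U hU
  obtain ⟨p, A, hA, hwA, hAU⟩ := h.isPretrim.exists_isTrimSet hU
  exact ⟨_, A, h.isTrimSet_idPartition hA, hwA, hAU⟩

end IdealCompletion

/-! ### Isomorphism of principal ideals and product decompositions -/

section IdealIso

variable {W : Type*} [TopologicalSpace W]

theorem IdealIso.symm {A B : CompactOpens W} (h : IdealIso A B) : IdealIso B A :=
  h.map OrderIso.symm

theorem IdealIso.trans {A B C : CompactOpens W} (h : IdealIso A B) (h' : IdealIso B C) :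
    IdealIso A C :=
  h.elim fun e => h'.map e.trans

theorem idealIso_apply {A B : CompactOpens W} (f : Set.Iic A ≃o Set.Iic B) (c : Set.Iic A) :
    IdealIso c.1 (f c).1 := by
  refine ⟨⟨⟨fun d => ⟨(f ⟨d.1, Set.mem_Iic.2 (le_trans d.2 c.2)⟩).1, f.monotone (Subtype.mk_le_mk.2 d.2)⟩,
    fun d => ⟨(f.symm ⟨d.1, Set.mem_Iic.2 (le_trans d.2 (f c).2)⟩).1, ?_⟩, fun d => ?_, fun d => ?_⟩,
    fun {d d'} => ?_⟩⟩
  · have : f.symm ⟨d.1, Set.mem_Iic.2 (le_trans d.2 (f c).2)⟩ ≤ f.symm (f c) :=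
      f.symm.monotone (Subtype.mk_le_mk.2 d.2)
    rwa [f.symm_apply_apply] at this
  · simp
  · simp
  · exact f.le_iff_le (x := ⟨d.1, Set.mem_Iic.2 (le_trans d.2 c.2)⟩) (y := ⟨d'.1, Set.mem_Iic.2 (le_trans d'.2 c.2)⟩)

variable [T2Space W]

theorem sdiff_eq_of_sup_eq_of_disjoint {α : Type*} [GeneralizedBooleanAlgebra α] {a b c : α}
    (h : b ⊔ c = a) (hd : Disjoint b c) : a \ b = c := by
  rw [← h, sup_sdiff_left_self, hd.symm.sdiff_eq_left]

theorem apply_sdiff {A B : CompactOpens W} (f : Set.Iic A ≃o Set.Iic B) (c : Set.Iic A) :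
    (f ⟨A \ c.1, Set.mem_Iic.2 sdiff_le⟩).1 = B \ (f c).1 := by
  have h : IsCompl c ⟨A \ c.1, Set.mem_Iic.2 sdiff_le⟩ := by
    rw [Set.Iic.isCompl_iff]
    exact ⟨disjoint_sdiff_self_right, sup_sdiff_cancel_right c.2⟩
  have h' := Set.Iic.isCompl_iff.1 (f.isCompl_iff.1 h)
  exact (sdiff_eq_of_sup_eq_of_disjoint h'.2 h'.1).symm

theorem IsPI.of_idealIso {A B : CompactOpens W} (hA : IsPI A) (h : IdealIso A B) : IsPI B := by
  obtain ⟨f⟩ := h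
  refine ⟨fun hB => hA.1 ?_, fun D hD => ?_⟩
  · have h1 : (⊤ : Set.Iic A) ≤ ⊥ := by
      rw [← f.le_iff_le, map_top, map_bot]
      exact hB.le
    exact le_bot_iff.1 h1
  · have h1 := idealIso_apply f.symm ⟨D, hD⟩
    have h2 := idealIso_apply f.symm ⟨B \ D, Set.mem_Iic.2 sdiff_le⟩
    rw [apply_sdiff f.symm ⟨D, hD⟩] at h2
    exact (hA.2 _ (f.symm ⟨D, hD⟩).2).imp (fun h => (h1.trans h).trans ⟨f⟩)
      fun h => (h2.trans h).trans ⟨f⟩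

/-- The ideal generated by a disjoint union is a product. -/
theorem nonempty_prod_orderIso_sdiff {A D : CompactOpens W} (hD : D ≤ A) :
    Nonempty (Set.Iic (A \ D) × Set.Iic D ≃o Set.Iic A) := by
  refine ⟨⟨⟨fun c => ⟨c.1.1 ⊔ c.2.1, sup_le (le_trans c.1.2 sdiff_le) (le_trans c.2.2 hD)⟩,
    fun c => (⟨c.1 \ D, Set.mem_Iic.2 (sdiff_le_sdiff_right c.2)⟩, ⟨c.1 ⊓ D, Set.mem_Iic.2 inf_le_right⟩),
    fun c => ?_, fun c => ?_⟩, fun {c d} => ?_⟩⟩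
  · have h1 := Disjoint.mono c.1.2 c.2.2 (disjoint_sdiff_self_left : Disjoint (A \ D) D)
    have h2 : Disjoint c.1.1 D := (disjoint_sdiff_self_left : Disjoint (A \ D) D).mono_left c.1.2
    refine Prod.ext (Subtype.ext ?_) (Subtype.ext ?_)
    · change (c.1.1 ⊔ c.2.1) \ D = c.1.1
      rw [sup_sdiff, h2.sdiff_eq_left, sdiff_eq_bot_iff.2 (show c.2.1 ≤ D from c.2.2), sup_bot_eq]
    · change (c.1.1 ⊔ c.2.1) ⊓ D = c.2.1
      rw [inf_sup_right, h2.eq_bot, bot_sup_eq, inf_eq_left.2 c.2.2]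
  · refine Subtype.ext ?_
    change c.1 \ D ⊔ c.1 ⊓ D = c.1
    rw [sup_comm, sup_inf_sdiff]
  · have h2 : Disjoint c.1.1 D := (disjoint_sdiff_self_left : Disjoint (A \ D) D).mono_left c.1.2
    have h3 : Disjoint d.1.1 D := (disjoint_sdiff_self_left : Disjoint (A \ D) D).mono_left d.1.2
    constructor
    · intro h
      replace h : c.1.1 ⊔ c.2.1 ≤ d.1.1 ⊔ d.2.1 := h
      constructor
      · exact Disjoint.left_le_of_le_sup_right (le_sup_left.trans h)
          (h2.mono_right (show d.2.1 ≤ D from d.2.2))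
      · exact Disjoint.left_le_of_le_sup_left (le_sup_right.trans h)
          (h3.symm.mono_left (show c.2.1 ≤ D from c.2.2))
    · rintro ⟨h, h'⟩
      exact sup_le_sup (show c.1.1 ≤ d.1.1 from h) (show c.2.1 ≤ d.2.1 from h')

/-- The images of `(⊥, ⊤)` and `(⊤, ⊥)` are complementary in `C`, and each factor is the principal
ideal below its own image. -/
theorem exists_le_idealIso_of_prod {A B C : CompactOpens W}
    (e : Set.Iic A × Set.Iic B ≃o Set.Iic C) :
    ∃ D ≤ C, IdealIso D B ∧ IdealIso (C \ D) A := by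
  have hcompl : IsCompl (e (⊥, ⊤)) (e (⊤, ⊥)) := by
    refine e.isCompl_iff.1 ?_
    rw [Prod.isCompl_iff]
    exact ⟨isCompl_bot_top, isCompl_top_bot⟩
  have h' := Set.Iic.isCompl_iff.1 hcompl
  have hsd : C \ (e (⊥, ⊤)).1 = (e (⊤, ⊥)).1 := by
    exact sdiff_eq_of_sup_eq_of_disjoint h'.2 h'.1
  refine ⟨(e (⊥, ⊤)).1, (e (⊥, ⊤)).2, ?_, ?_⟩
  · refine IdealIso.symm ⟨⟨⟨fun b => ⟨(e (⊥, b)).1, e.monotone ⟨le_rfl, le_top⟩⟩,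
      fun c => (e.symm ⟨c.1, Set.mem_Iic.2 (le_trans c.2 (e (⊥, ⊤)).2)⟩).2, fun b => ?_, fun c => ?_⟩,
      fun {b b'} => ?_⟩⟩
    · simp
    · refine Subtype.ext ?_
      have h1 : e.symm ⟨c.1, Set.mem_Iic.2 (le_trans c.2 (e (⊥, ⊤)).2)⟩ ≤ e.symm (e (⊥, ⊤)) :=
        e.symm.monotone (Subtype.mk_le_mk.2 c.2)
      rw [e.symm_apply_apply] at h1
      have h2 : ((⊥, (e.symm ⟨c.1, Set.mem_Iic.2 (le_trans c.2 (e (⊥, ⊤)).2)⟩).2) : Set.Iic A × Set.Iic B) =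
          e.symm ⟨c.1, Set.mem_Iic.2 (le_trans c.2 (e (⊥, ⊤)).2)⟩ := Prod.ext (le_bot_iff.1 h1.1).symm rfl
      change (e (⊥, _)).1 = c.1
      rw [h2, e.apply_symm_apply]
    · refine (e.le_iff_le (x := (⊥, b)) (y := (⊥, b'))).trans ?_
      exact ⟨fun h => h.2, fun h => ⟨le_rfl, h⟩⟩
  · rw [hsd]
    refine IdealIso.symm ⟨⟨⟨fun b => ⟨(e (b, ⊥)).1, e.monotone ⟨le_top, le_rfl⟩⟩,
      fun c => (e.symm ⟨c.1, Set.mem_Iic.2 (le_trans c.2 (e (⊤, ⊥)).2)⟩).1, fun b => ?_, fun c => ?_⟩,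
      fun {b b'} => ?_⟩⟩
    · simp
    · refine Subtype.ext ?_
      have h1 : e.symm ⟨c.1, Set.mem_Iic.2 (le_trans c.2 (e (⊤, ⊥)).2)⟩ ≤ e.symm (e (⊤, ⊥)) :=
        e.symm.monotone (Subtype.mk_le_mk.2 c.2)
      rw [e.symm_apply_apply] at h1
      have h2 : (((e.symm ⟨c.1, Set.mem_Iic.2 (le_trans c.2 (e (⊤, ⊥)).2)⟩).1, ⊥) : Set.Iic A × Set.Iic B) =
          e.symm ⟨c.1, Set.mem_Iic.2 (le_trans c.2 (e (⊤, ⊥)).2)⟩ := Prod.ext rfl (le_bot_iff.1 h1.2).symm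
      change (e (_, ⊥)).1 = c.1
      rw [h2, e.apply_symm_apply]
    · refine (e.le_iff_le (x := (b, ⊥)) (y := (b', ⊥))).trans ?_
      exact ⟨fun h => h.1, fun h => ⟨h, le_rfl⟩⟩

end IdealIso

/-! ### The structure diagram and limit points of the canonical partition -/

section StructureDiagram

variable {W : Type*} [TopologicalSpace W] [T2Space W]

/-- `A` is pseudo-indecomposable of isomorphism class `p`. -/
def HasClass (p : StructureDiagram W) (A : CompactOpens W) : Prop :=
  ∃ hA : IsPI A, isoClass A hA = p

theorem exists_hasClass (p : StructureDiagram W) : ∃ A, HasClass p A := by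
  induction p using Quotient.inductionOn with
  | h A => exact ⟨A.1, A.2, rfl⟩

theorem HasClass.idealIso {p : StructureDiagram W} {A B : CompactOpens W} (hA : HasClass p A)
    (hB : HasClass p B) : IdealIso A B := by
  obtain ⟨hA, rfl⟩ := hA
  obtain ⟨hB, h⟩ := hB
  exact (Quotient.exact (s := piSetoid W) h : IdealIso B A).symm

theorem HasClass.eq {p q : StructureDiagram W} {A B : CompactOpens W} (hA : HasClass p A)
    (hB : HasClass q B) (h : IdealIso A B) : p = q := by
  obtain ⟨hA, rfl⟩ := hA
  obtain ⟨hB, rfl⟩ := hB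
  exact Quotient.sound (s := piSetoid W) h

theorem HasClass.of_idealIso {p : StructureDiagram W} {A B : CompactOpens W} (hA : HasClass p A)
    (h : IdealIso A B) : HasClass p B := by
  obtain ⟨hA, rfl⟩ := hA
  exact ⟨hA.of_idealIso h, (Quotient.sound (s := piSetoid W) h).symm⟩

theorem structureLT_iff {p q : StructureDiagram W} {A B : CompactOpens W} (hA : HasClass p A)
    (hB : HasClass q B) :
    structureLT W p q ↔ Nonempty (Set.Iic A × Set.Iic B ≃o Set.Iic A) := by
  obtain ⟨hA, rfl⟩ := hA
  obtain ⟨hB, rfl⟩ := hB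
  exact Iff.rfl

/-- This trades the external product condition for a splitting of `A` itself, the form in which PI
sets are manipulated below. -/
theorem structureLT_iff_exists {p q : StructureDiagram W} {A : CompactOpens W}
    (hA : HasClass p A) :
    structureLT W p q ↔ ∃ D ≤ A, HasClass q D ∧ HasClass p (A \ D) := by
  constructor
  · intro h
    obtain ⟨B, hB⟩ := exists_hasClass q
    obtain ⟨e⟩ := (structureLT_iff hA hB).1 h
    obtain ⟨D, hD, h1, h2⟩ := exists_le_idealIso_of_prod e
    exact ⟨D, hD, hB.of_idealIso h1.symm, hA.of_idealIso h2.symm⟩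
  · rintro ⟨D, hD, h1, h2⟩
    rw [structureLT_iff hA h1]
    obtain ⟨e⟩ := nonempty_prod_orderIso_sdiff hD
    obtain ⟨f⟩ := hA.idealIso h2
    exact ⟨(prodOrderIso f (OrderIso.refl _)).trans e⟩

theorem isPOSystem_structureLT : IsPOSystem (structureLT W) where
  trans := by
    intro p q r hpq hqr
    obtain ⟨A, hA⟩ := exists_hasClass p
    obtain ⟨B, hB⟩ := exists_hasClass q
    obtain ⟨C, hC⟩ := exists_hasClass r
    obtain ⟨e⟩ := (structureLT_iff hA hB).1 hpq
    obtain ⟨f⟩ := (structureLT_iff hB hC).1 hqr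
    rw [structureLT_iff hA hC]
    -- With `A`, `B`, `C` standing for their ideals: `A × C ≅ (A × B) × C ≅ A × (B × C) ≅ A × B ≅
    -- A`.
    exact ⟨((((prodOrderIso e.symm (OrderIso.refl _)).trans (OrderIso.prodAssoc _ _ _)).trans
      (prodOrderIso (OrderIso.refl _) f)).trans e)⟩
  antisymm := by
    intro p q hpq hqp
    obtain ⟨A, hA⟩ := exists_hasClass p
    obtain ⟨B, hB⟩ := exists_hasClass q
    obtain ⟨e⟩ := (structureLT_iff hA hB).1 hpq
    obtain ⟨f⟩ := (structureLT_iff hB hA).1 hqp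
    -- With the same convention: `A ≅ A × B ≅ B × A ≅ B`.
    exact hA.eq hB ⟨(e.symm.trans OrderIso.prodComm).trans f⟩

theorem HasClass.leOf_of_le {p q : StructureDiagram W} {A B : CompactOpens W} (hA : HasClass p A)
    (hB : HasClass q B) (hBA : B ≤ A) : leOf (structureLT W) p q := by
  rcases hA.1.2 B hBA with h | h
  · exact Or.inr (hA.eq hB h.symm)
  · exact Or.inl ((structureLT_iff_exists hA).2 ⟨B, hBA, hB, hA.of_idealIso h.symm⟩)

theorem mem_canonicalPartition_iff {p : StructureDiagram W} {w : W} :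
    w ∈ canonicalPartition W p ↔
      ∀ U ∈ 𝓝 w, ∃ A : CompactOpens W, HasClass p A ∧ w ∈ A ∧ (A : Set W) ⊆ U := by
  simp only [canonicalPartition, HasClass, Set.mem_ofPred_eq, exists_and_right]

theorem HasClass.leOf_of_mem {p q : StructureDiagram W} {A : CompactOpens W} (hA : HasClass p A)
    {w : W} (hw : w ∈ A) (hwq : w ∈ canonicalPartition W q) : leOf (structureLT W) p q := by
  obtain ⟨B, hB, -, hBA⟩ := mem_canonicalPartition_iff.1 hwq A (A.isOpen.mem_nhds hw)
  exact hA.leOf_of_le hB hBA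

theorem canonicalPartition_eq_of_mem {p q : StructureDiagram W} {w : W}
    (hp : w ∈ canonicalPartition W p) (hq : w ∈ canonicalPartition W q) : p = q := by
  obtain ⟨A, hA, hwA, -⟩ := mem_canonicalPartition_iff.1 hp Set.univ Filter.univ_mem
  obtain ⟨B, hB, hwB, -⟩ := mem_canonicalPartition_iff.1 hq Set.univ Filter.univ_mem
  exact isPOSystem_structureLT.le_antisymm (hA.leOf_of_mem hwA hq) (hB.leOf_of_mem hwB hp)

/-- Sets of class `p` contain two disjoint sets of class `p`. -/
def IsMultiple (p : StructureDiagram W) : Prop :=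
  ∃ A : CompactOpens W, HasClass p A ∧ ∃ D ≤ A, ∃ D' ≤ A, HasClass p D ∧ HasClass p D' ∧
    Disjoint D D'

theorem IsMultiple.exists_disjoint {p : StructureDiagram W} (h : IsMultiple p)
    {B : CompactOpens W} (hB : HasClass p B) : ∃ D ≤ B, ∃ D' ≤ B, HasClass p D ∧ HasClass p D' ∧
    Disjoint D D' := by
  obtain ⟨A, hA, D, hDA, D', hDA', hD, hD', hdisj⟩ := h
  obtain ⟨f⟩ := hA.idealIso hB
  refine ⟨(f ⟨D, hDA⟩).1, (f ⟨D, hDA⟩).2, (f ⟨D', hDA'⟩).1, (f ⟨D', hDA'⟩).2,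
    hD.of_idealIso (idealIso_apply f ⟨D, hDA⟩), hD'.of_idealIso (idealIso_apply f ⟨D', hDA'⟩), ?_⟩
  have h1 : Disjoint (⟨D, hDA⟩ : Set.Iic A) ⟨D', hDA'⟩ := Set.Iic.disjoint_iff.2 hdisj
  exact Set.Iic.disjoint_iff.1 (h1.map_orderIso f)

/-- The relation on the structure diagram given by limit points of the canonical partition. -/
def limitLT (p q : StructureDiagram W) : Prop := structureLT W p q ∨ (p = q ∧ IsMultiple p)

theorem isPOSystem_limitLT : IsPOSystem (limitLT (W := W)) where
  trans := by
    rintro p q r (h | ⟨rfl, h⟩) (h' | ⟨rfl, h'⟩)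
    · exact Or.inl (isPOSystem_structureLT.trans _ _ _ h h')
    · exact Or.inl h
    · exact Or.inl h'
    · exact Or.inr ⟨rfl, h⟩
  antisymm := by
    rintro p q (h | ⟨rfl, h⟩) (h' | ⟨h', -⟩)
    · exact isPOSystem_structureLT.antisymm _ _ h h'
    · exact h'.symm
    · rfl
    · rfl

theorem limitLT_of_leOf {p q : StructureDiagram W} (h : leOf (structureLT W) p q) :
    leOf limitLT p q :=
  h.imp_left Or.inl

theorem HasClass.isMultiple {p : StructureDiagram W} {A : CompactOpens W} (hA : HasClass p A)
    {v w : W} (hv : v ∈ A) (hvp : v ∈ canonicalPartition W p) (hw : w ∈ A)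
    (hwp : w ∈ canonicalPartition W p) (hvw : v ≠ w) : IsMultiple p := by
  obtain ⟨U, V, hU, hV, hvU, hwV, hUV⟩ := t2_separation hvw
  obtain ⟨D, hD, -, hDU⟩ := mem_canonicalPartition_iff.1 hvp _
    (Filter.inter_mem (A.isOpen.mem_nhds hv) (hU.mem_nhds hvU))
  obtain ⟨D', hD', -, hDV⟩ := mem_canonicalPartition_iff.1 hwp _
    (Filter.inter_mem (A.isOpen.mem_nhds hw) (hV.mem_nhds hwV))
  exact ⟨A, hA, D, fun u hu => (hDU hu).1, D', fun u hu => (hDV hu).1, hD, hD',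
    compactOpens_disjoint_iff.2 fun u hu hu' => Set.disjoint_left.1 hUV (hDU hu).2 (hDV hu').2⟩

variable [LocallyCompactSpace W] [TotallyDisconnectedSpace W] [Countable (CompactOpens W)]

/-- Pseudo-indecomposability lets each compact open set be decided in turn without leaving the
class: one of `B ⊓ C n` and its complement in `B` is isomorphic to `B`. A point common to the
resulting compact sets has them as a neighbourhood base. -/
theorem HasClass.exists_mem {p : StructureDiagram W} {A : CompactOpens W} (hA : HasClass p A) :
    ∃ w ∈ A, w ∈ canonicalPartition W p := by
  obtain ⟨C, hC⟩ := exists_surjective_nat (CompactOpens W)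
  let T := {B : CompactOpens W // HasClass p B}
  have step : ∀ (n : ℕ) (B : T), ∃ B' : T, B'.1 ≤ B.1 ∧ (B'.1 ≤ C n ∨ Disjoint B'.1 (C n)) := by
    rintro n ⟨B, hB⟩
    rcases hB.1.2 (B ⊓ C n) inf_le_left with h | h
    · exact ⟨⟨B ⊓ C n, hB.of_idealIso h.symm⟩, inf_le_left, Or.inl inf_le_right⟩
    · exact ⟨⟨B \ (B ⊓ C n), hB.of_idealIso h.symm⟩, sdiff_le, Or.inr <|
        compactOpens_disjoint_iff.2 fun v hv hvC => hv.2 ⟨hv.1, hvC⟩⟩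
  choose next hle hdec using step
  let S : ℕ → T := fun n => Nat.rec ⟨A, hA⟩ next n
  have hS : ∀ n, S (n + 1) = next n (S n) := fun n => rfl
  obtain ⟨y, hy⟩ : (⋂ n, ((S n).1 : Set W)).Nonempty := by
    refine IsCompact.nonempty_iInter_of_sequence_nonempty_isCompact_isClosed _ (fun n => ?_)
      (fun n => ?_) (S 0).1.isCompact fun n => (S n).1.isCompact.isClosed
    · rw [hS]
      exact hle n (S n)
    · exact compactOpens_ne_bot_iff.1 (S n).2.1.1
  rw [Set.mem_iInter] at hy
  refine ⟨y, hy 0, mem_canonicalPartition_iff.2 fun U hU => ?_⟩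
  obtain ⟨D, hyD, hDU⟩ := exists_compactOpens_mem_subset hU
  obtain ⟨n, rfl⟩ := hC D
  refine ⟨(S (n + 1)).1, (S (n + 1)).2, hy (n + 1), ?_⟩
  rcases hdec n (S n) with h1 | h1
  · exact fun v hv => hDU (h1 hv)
  · exact (compactOpens_disjoint_iff.1 h1 y (hy (n + 1)) hyD).elim

theorem mem_derivedSet_canonicalPartition_iff {p q : StructureDiagram W} {w : W}
    (hw : w ∈ canonicalPartition W p) :
    w ∈ derivedSet (canonicalPartition W q) ↔ limitLT p q := by
  rw [mem_derivedSet_iff_nhds]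
  constructor
  · intro h
    obtain ⟨A, hA, hwA, -⟩ := mem_canonicalPartition_iff.1 hw Set.univ Filter.univ_mem
    obtain ⟨z, hzA, hzq, hzw⟩ := h A (A.isOpen.mem_nhds hwA)
    rcases hA.leOf_of_mem hzA hzq with h1 | rfl
    · exact Or.inl h1
    · exact Or.inr ⟨rfl, hA.isMultiple hzA hzq hwA hw hzw⟩
  · intro h U hU
    obtain ⟨A, hA, hwA, hAU⟩ := mem_canonicalPartition_iff.1 hw U hU
    obtain ⟨D, hDA, D', hDA', hD, hD', hdisj⟩ : ∃ D ≤ A, ∃ D' ≤ A, HasClass q D ∧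
        HasClass p D' ∧ Disjoint D D' := by
      rcases h with h | ⟨rfl, h⟩
      · obtain ⟨D, hDA, hD, hAD⟩ := (structureLT_iff_exists hA).1 h
        exact ⟨D, hDA, A \ D, sdiff_le, hD, hAD, disjoint_sdiff_self_right⟩
      · exact h.exists_disjoint hA
    obtain ⟨z, hzD, hzq⟩ := hD.exists_mem
    -- If the point found in `D` is `w` itself, then `p = q`, and the disjoint set `D'` of class `p`
    -- supplies another point.
    by_cases hzw : z = w
    · subst hzw
      obtain rfl := canonicalPartition_eq_of_mem hw hzq
      obtain ⟨y, hyD, hyp⟩ := hD'.exists_mem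
      refine ⟨y, hAU (hDA' hyD), hyp, ?_⟩
      rintro rfl
      exact compactOpens_disjoint_iff.1 hdisj y hzD hyD
    · exact ⟨z, hAU (hDA hzD), hzq, hzw⟩

end StructureDiagram

/-! ### A pointwise criterion for being a partition -/

section Partitions

variable {W : Type*} [TopologicalSpace W] {P : Type*} {lt : P → P → Prop} {X : P → Set W}

theorem isPPartition_of_mem_derivedSet_iff (hPO : IsPOSystem lt) (hne : ∀ p, (X p).Nonempty)
    (hdisj : ∀ p q, ∀ w ∈ X p, w ∈ X q → p = q)
    (hder : ∀ p q, ∀ w ∈ X p, w ∈ derivedSet (X q) ↔ lt p q) : IsPPartition lt X where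
  poSystem := hPO
  nonempty := hne
  disjoint p q hpq := Set.disjoint_left.2 fun w hp hq => hpq (hdisj p q w hp hq)
  derived p := by
    ext w
    simp only [Set.mem_inter_iff, Set.mem_iUnion, Set.mem_ofPred_eq, exists_prop]
    constructor
    · rintro ⟨h, q, hq⟩
      exact ⟨q, (hder q p w hq).1 h, hq⟩
    · rintro ⟨q, h, hq⟩
      exact ⟨(hder q p w hq).2 h, q, hq⟩

end Partitions

/-! ### Trimness of the canonical partition -/

section Canonical

variable {W : Type*} [TopologicalSpace W] [T2Space W] [LocallyCompactSpace W]
  [TotallyDisconnectedSpace W] [Countable (CompactOpens W)]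

theorem isPPartition_limitLT : IsPPartition limitLT (canonicalPartition W) := by
  refine isPPartition_of_mem_derivedSet_iff isPOSystem_limitLT (fun p => ?_)
    (fun p q w => canonicalPartition_eq_of_mem)
    (fun p q w => mem_derivedSet_canonicalPartition_iff)
  obtain ⟨A, hA⟩ := exists_hasClass p
  obtain ⟨w, -, hw⟩ := hA.exists_mem
  exact ⟨w, hw⟩

theorem HasClass.isTrimSet_limitLT {p : StructureDiagram W} {A : CompactOpens W}
    (hA : HasClass p A) : IsTrimSet limitLT (canonicalPartition W) p (A : Set W) := by
  obtain ⟨v, hv, hvp⟩ := hA.exists_mem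
  refine isPPartition_limitLT.isTrimSet (fun q w hw hwq => limitLT_of_leOf (hA.leOf_of_mem hw hwq))
    hv hvp fun hp w hw hwp => ?_
  by_contra hwv
  exact hp (Or.inr ⟨rfl, hA.isMultiple hw hwp hv hvp hwv⟩)

/-- Primitivity enters through T1: a compact open neighbourhood splits into PI sets, one of which
contains the point. -/
theorem isPretrim_limitLT (hW : IsPrimitive W) : IsPretrim limitLT (canonicalPartition W) where
  isPPartition := isPPartition_limitLT
  t1 w U hU := by
    obtain ⟨C, hwC, hCU⟩ := exists_compactOpens_mem_subset hU
    obtain ⟨s, hs, -, hsup⟩ := hW C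
    obtain ⟨B, hB, hwB⟩ := (compactOpens_mem_finset_sup s w).1 (hsup ▸ hwC)
    have hBC : B ≤ C := hsup ▸ Finset.le_sup (f := id) hB
    exact ⟨isoClass B (hs B hB), B, HasClass.isTrimSet_limitLT ⟨hs B hB, rfl⟩, hwB,
      fun v hv => hCU (hBC hv)⟩
  t3 p w hw := by
    obtain ⟨A, hA, hwA, -⟩ := mem_canonicalPartition_iff.1 hw Set.univ Filter.univ_mem
    exact ⟨A, hA.isTrimSet_limitLT, hwA⟩

/-- Two disjoint subsets `D`, `D'` of class `p` in `A` do not visibly give `(A) × (A) ≅ (A)`. But `D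
⊔ D'` and `A` are both `p`-trim for `limitLT`, hence isomorphic by uniqueness, and the splitting of
`D ⊔ D'` transports to `A`. The detour through `limitLT` makes uniqueness available before this is
known. -/
theorem limitLT_eq_structureLT (hW : IsPrimitive W) : limitLT = structureLT W := by
  funext p q
  refine propext ⟨?_, Or.inl⟩
  rintro (h | ⟨rfl, A, hA, D, hDA, D', hDA', hD, hD', hdisj⟩)
  · exact h
  obtain ⟨v, hv, hvp⟩ := hD.exists_mem
  have hAt := hA.isTrimSet_limitLT
  obtain ⟨f⟩ := (isPretrim_limitLT hW).idealIso
    (isPPartition_limitLT.isTrimSet_of_le hAt (sup_le hDA hDA') (Or.inl hv) hvp) hAt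
  have h1 := idealIso_apply f ⟨D, Set.mem_Iic.2 le_sup_left⟩
  have h2 : IdealIso ((D ⊔ D') \ D) (A \ (f ⟨D, Set.mem_Iic.2 le_sup_left⟩).1) := by
    rw [← apply_sdiff f ⟨D, Set.mem_Iic.2 le_sup_left⟩]
    exact idealIso_apply f ⟨(D ⊔ D') \ D, Set.mem_Iic.2 sdiff_le⟩
  rw [sdiff_eq_of_sup_eq_of_disjoint rfl hdisj] at h2
  exact (structureLT_iff_exists hA).2 ⟨_, (f ⟨D, Set.mem_Iic.2 le_sup_left⟩).2,
    hD.of_idealIso h1, hD'.of_idealIso h2⟩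

theorem isPretrim_canonicalPartition (hW : IsPrimitive W) :
    IsPretrim (structureLT W) (canonicalPartition W) :=
  limitLT_eq_structureLT hW ▸ isPretrim_limitLT hW

theorem HasClass.isTrimSet (hW : IsPrimitive W) {p : StructureDiagram W} {A : CompactOpens W}
    (hA : HasClass p A) : IsTrimSet (structureLT W) (canonicalPartition W) p (A : Set W) :=
  limitLT_eq_structureLT hW ▸ hA.isTrimSet_limitLT

/-- A `p`-trim set is isomorphic to any representative of `p`, which is itself `p`-trim. Trimness is
thereby intrinsic to the Boolean ring, which yields T2 and invariance under homeomorphisms. -/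
theorem isTrimSet_canonicalPartition_iff (hW : IsPrimitive W) {p : StructureDiagram W}
    {A : CompactOpens W} :
    IsTrimSet (structureLT W) (canonicalPartition W) p (A : Set W) ↔ HasClass p A := by
  refine ⟨fun hA => ?_, fun hA => hA.isTrimSet hW⟩
  obtain ⟨B, hB⟩ := exists_hasClass p
  exact hB.of_idealIso ((isPretrim_canonicalPartition hW).idealIso (hB.isTrimSet hW) hA)

/-- The canonical partition of a primitive space is a trim partition. -/
theorem isTrimPartition_canonicalPartition (hW : IsPrimitive W) :
    IsTrimPartition (structureLT W) (canonicalPartition W) where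
  isPPartition := (isPretrim_canonicalPartition hW).isPPartition
  t1 := (isPretrim_canonicalPartition hW).t1
  t2 p _ w hw := mem_canonicalPartition_iff.2 fun U hU => by
    obtain ⟨A, hA, hwA, hAU⟩ := hw U hU
    obtain ⟨A, rfl⟩ := hA.exists_eq_coe
    exact ⟨A, (isTrimSet_canonicalPartition_iff hW).1 hA, hwA, hAU⟩
  t3 := (isPretrim_canonicalPartition hW).t3

end Canonical

/-! ### Reindexing partitions along an isomorphism of PO systems -/

section Transport

variable {W : Type*} [TopologicalSpace W] {P Q : Type*} {lt : P → P → Prop} {X : P → Set W}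
  {lt' : Q → Q → Prop} {Z : Q → Set W}

theorem IsPPartition.of_equiv (h : IsPPartition lt X) (e : P ≃ Q)
    (hlt : ∀ p q, lt p q ↔ lt' (e p) (e q)) (hX : ∀ p, X p = Z (e p)) : IsPPartition lt' Z := by
  refine isPPartition_of_mem_derivedSet_iff ⟨?_, ?_⟩ ?_ ?_ ?_ <;>
    simp only [e.surjective.forall, ← hX, ← hlt, e.apply_eq_iff_eq]
  · exact h.poSystem.trans
  · exact h.poSystem.antisymm
  · exact h.nonempty
  · exact fun p q w => h.eq_of_mem
  · exact fun p q w => h.mem_derivedSet_iff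

theorem IsTrimSet.of_equiv {p : P} {A : Set W} (h : IsTrimSet lt X p A) (e : P ≃ Q)
    (hlt : ∀ p q, lt p q ↔ lt' (e p) (e q)) (hX : ∀ p, X p = Z (e p)) :
    IsTrimSet lt' Z (e p) A where
  isCompact := h.isCompact
  isOpen := h.isOpen
  type_eq := by
    ext q
    obtain ⟨q, rfl⟩ := e.surjective q
    have := Set.ext_iff.1 h.type_eq q
    simpa only [typeOf, leOf, Set.mem_ofPred_eq, ← hX, ← hlt, e.apply_eq_iff_eq] using this
  card_eq := by
    rw [← hlt, ← hX]
    exact h.card_eq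

theorem T1.of_equiv (h : T1 lt X) (e : P ≃ Q) (hlt : ∀ p q, lt p q ↔ lt' (e p) (e q))
    (hX : ∀ p, X p = Z (e p)) : T1 lt' Z := by
  intro w U hU
  obtain ⟨p, A, hA, hw⟩ := h w U hU
  exact ⟨e p, A, hA.of_equiv e hlt hX, hw⟩

end Transport

/-! ### Orbits as blocks of the ideal completion -/

section Orbits

variable {W : Type*} [TopologicalSpace W]

theorem mem_homeoOrbit_self (w : W) : w ∈ homeoOrbit w := ⟨Homeomorph.refl W, rfl⟩

variable [T2Space W]

theorem HasClass.mapCompactOpens {p : StructureDiagram W} {A : CompactOpens W} (hA : HasClass p A)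
    (h : W ≃ₜ W) : HasClass p (mapCompactOpens h A) :=
  hA.of_idealIso ⟨iicOrderIso (PrimitiveSpace.mapCompactOpens h) A⟩

variable [LocallyCompactSpace W] [TotallyDisconnectedSpace W] [Countable (CompactOpens W)]

theorem mem_trimTypes_canonicalPartition_iff (hW : IsPrimitive W) {p : StructureDiagram W} {w : W} :
    p ∈ trimTypes (structureLT W) (canonicalPartition W) w ↔ ∃ A, HasClass p A ∧ w ∈ A := by
  constructor
  · rintro ⟨A, hA, hw⟩
    obtain ⟨A, rfl⟩ := hA.exists_eq_coe
    exact ⟨A, (isTrimSet_canonicalPartition_iff hW).1 hA, hw⟩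
  · rintro ⟨A, hA, hw⟩
    exact ⟨A, hA.isTrimSet hW, hw⟩

theorem trimTypes_apply_homeomorph (hW : IsPrimitive W) (h : W ≃ₜ W) (w : W) :
    trimTypes (structureLT W) (canonicalPartition W) (h w) =
      trimTypes (structureLT W) (canonicalPartition W) w := by
  have key : ∀ (h : W ≃ₜ W) (w : W), trimTypes (structureLT W) (canonicalPartition W) w ⊆
      trimTypes (structureLT W) (canonicalPartition W) (h w) := by
    intro h w p
    rw [mem_trimTypes_canonicalPartition_iff hW, mem_trimTypes_canonicalPartition_iff hW]
    rintro ⟨A, hA, hw⟩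
    exact ⟨_, hA.mapCompactOpens h, w, hw, rfl⟩
  refine Set.Subset.antisymm ?_ (key h w)
  have := key h.symm (h w)
  rwa [h.symm_apply_apply] at this

theorem mem_homeoOrbit_iff (hW : IsPrimitive W) {w x : W} :
    x ∈ homeoOrbit w ↔ trimTypes (structureLT W) (canonicalPartition W) x =
      trimTypes (structureLT W) (canonicalPartition W) w := by
  constructor
  · rintro ⟨h, rfl⟩
    exact trimTypes_apply_homeomorph hW h w
  · intro h
    exact (isPretrim_canonicalPartition hW).exists_homeomorph h.symm

theorem homeoOrbit_eq_idPartition (hW : IsPrimitive W) (w : W) :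
    homeoOrbit w = idPartition (structureLT W) (canonicalPartition W)
      ((isPretrim_canonicalPartition hW).ideal w) :=
  Set.ext fun _ => mem_homeoOrbit_iff hW

theorem idPartition_eq_homeoOrbit (hW : IsPrimitive W) {J : IdealCompletion (structureLT W)} {w : W}
    (hw : w ∈ idPartition (structureLT W) (canonicalPartition W) J) :
    idPartition (structureLT W) (canonicalPartition W) J = homeoOrbit w := by
  rw [homeoOrbit_eq_idPartition hW]
  congr 1
  exact Subtype.ext (show trimTypes _ _ w = J.1 from hw).symm

/-- The ideal completion of the canonical partition is the orbit diagram. -/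
theorem exists_equiv_orbitDiagram (hW : IsPrimitive W) :
    ∃ e : IdealCompletion (structureLT W) ≃ orbitDiagram W,
      (∀ J K, idLT (structureLT W) J K ↔ orbitLT W (e J) (e K)) ∧
      (∀ J, idPartition (structureLT W) (canonicalPartition W) J = orbitPartition W (e J)) := by
  have hT := isTrimPartition_canonicalPartition hW
  have hne := hT.isPretrim.idPartition_nonempty
  have horb : ∀ J, idPartition (structureLT W) (canonicalPartition W) J ∈ orbitDiagram W := by
    intro J
    obtain ⟨w, hw⟩ := hne J
    exact ⟨w, (idPartition_eq_homeoOrbit hW hw).symm⟩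
  let f : IdealCompletion (structureLT W) → orbitDiagram W := fun J => ⟨_, horb J⟩
  have hf : Function.Bijective f := by
    constructor
    · intro J K hJK
      obtain ⟨w, hw⟩ := hne J
      have hwK : w ∈ idPartition (structureLT W) (canonicalPartition W) K := by
        rw [← show idPartition _ _ J = idPartition _ _ K from congrArg Subtype.val hJK]
        exact hw
      exact Subtype.ext ((show trimTypes _ _ w = J.1 from hw).symm.trans hwK)
    · rintro ⟨_, w, rfl⟩
      exact ⟨_, Subtype.ext (homeoOrbit_eq_idPartition hW w).symm⟩
  refine ⟨Equiv.ofBijective f hf, fun J K => ?_, fun J => rfl⟩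
  -- `orbitLT` asks for a single limit point; in a partition, one point of a block decides the
  -- relation.
  change _ ↔ ∃ y ∈ idPartition _ _ J, y ∈ derivedSet (idPartition _ _ K)
  constructor
  · intro h
    obtain ⟨w, hw⟩ := hne J
    exact ⟨w, hw, (hT.isPPartition_idPartition.mem_derivedSet_iff hw).2 h⟩
  · rintro ⟨w, hw, hwK⟩
    exact (hT.isPPartition_idPartition.mem_derivedSet_iff hw).1 hwK

theorem isPPartition_orbitPartition (hW : IsPrimitive W) :
    IsPPartition (orbitLT W) (orbitPartition W) := by
  obtain ⟨e, hlt, hX⟩ := exists_equiv_orbitDiagram hW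
  exact (isTrimPartition_canonicalPartition hW).isPPartition_idPartition.of_equiv e hlt hX

theorem t1_orbitPartition (hW : IsPrimitive W) : T1 (orbitLT W) (orbitPartition W) := by
  obtain ⟨e, hlt, hX⟩ := exists_equiv_orbitDiagram hW
  exact (isTrimPartition_canonicalPartition hW).t1_idPartition.of_equiv e hlt hX

/-- The orbit diagram regularly consolidates the ideal completion of each trim partition. -/
theorem exists_regularlyRefines (hW : IsPrimitive W) {Q : Type*} {lt : Q → Q → Prop}
    {Y : Q → Set W} (hY : IsTrimPartition lt Y) : ∃ α : IdealCompletion lt → orbitDiagram W,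
      RegularlyRefines (idLT lt) (idPartition lt Y) (orbitLT W) (orbitPartition W) α := by
  choose x hx using hY.isPretrim.idPartition_nonempty
  have href : ∀ J, idPartition lt Y J ⊆ homeoOrbit (x J) := fun J w hw =>
    hY.isPretrim.exists_homeomorph ((show trimTypes lt Y (x J) = J.1 from hx J).trans
      (show trimTypes lt Y w = J.1 from hw).symm)
  refine ⟨fun J => ⟨homeoOrbit (x J), x J, rfl⟩, hY.isPPartition_idPartition,
    isPPartition_orbitPartition hW, hY.t1_idPartition, t1_orbitPartition hW, href, ?_⟩
  intro S A hA
  -- Regularity: `A` meets its own type `S` in some `w`, and the block containing `w` lies in a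
  -- single orbit, which must be `S`.
  obtain ⟨w, hwA, hwS⟩ := hA.exists_mem (leOf_refl S)
  refine ⟨hY.isPretrim.ideal w, ⟨w, hwA, rfl⟩, ?_⟩
  refine (isPPartition_orbitPartition hW).eq_of_mem (w := w) (href _ rfl) hwS

end Orbits

/-! ### Atoms of the prime TBA and their closures -/

section PrimeTBA

variable {W : Type*} [TopologicalSpace W]

theorem compl_mem_primeTBA {A : Set W} (hA : A ∈ primeTBA W) : Aᶜ ∈ primeTBA W :=
  fun F hF => hF.compl_mem A (hA F hF)

theorem sUnion_mem_primeTBA {G : Set (Set W)} (hG : G ⊆ primeTBA W) : ⋃₀ G ∈ primeTBA W :=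
  fun F hF => hF.sUnion_mem G fun _ hA => hG hA F hF

theorem derivedSet_mem_primeTBA {A : Set W} (hA : A ∈ primeTBA W) : derivedSet A ∈ primeTBA W :=
  fun F hF => hF.derivedSet_mem A (hA F hF)

theorem iUnion_mem_primeTBA {ι : Sort*} {f : ι → Set W} (hf : ∀ i, f i ∈ primeTBA W) :
    (⋃ i, f i) ∈ primeTBA W := by
  rw [← Set.sUnion_range]
  exact sUnion_mem_primeTBA (Set.range_subset_iff.2 hf)

theorem iInter_mem_primeTBA {ι : Sort*} {f : ι → Set W} (hf : ∀ i, f i ∈ primeTBA W) :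
    (⋂ i, f i) ∈ primeTBA W := by
  rw [← compl_compl (⋂ i, f i), Set.compl_iInter]
  exact compl_mem_primeTBA (iUnion_mem_primeTBA fun i => compl_mem_primeTBA (hf i))

theorem union_mem_primeTBA {A B : Set W} (hA : A ∈ primeTBA W) (hB : B ∈ primeTBA W) :
    A ∪ B ∈ primeTBA W := by
  rw [Set.union_eq_iUnion]
  exact iUnion_mem_primeTBA fun b => by cases b <;> assumption

theorem diff_mem_primeTBA {A B : Set W} (hA : A ∈ primeTBA W) (hB : B ∈ primeTBA W) :
    A \ B ∈ primeTBA W := by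
  rw [← compl_compl (A \ B), Set.compl_sdiff]
  exact compl_mem_primeTBA (union_mem_primeTBA hB (compl_mem_primeTBA hA))

theorem closure_mem_primeTBA {A : Set W} (hA : A ∈ primeTBA W) : closure A ∈ primeTBA W := by
  rw [closure_eq_self_union_derivedSet]
  exact union_mem_primeTBA hA (derivedSet_mem_primeTBA hA)

theorem mem_invariantSets_iff {A : Set W} :
    A ∈ invariantSets W ↔ ∀ h : W ≃ₜ W, ∀ w ∈ A, h w ∈ A := by
  constructor
  · intro hA h w hw
    have := hA h
    rw [← this]
    exact ⟨w, hw, rfl⟩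
  · intro hA h
    refine Set.Subset.antisymm (Set.image_subset_iff.2 fun w hw => hA h w hw) fun w hw => ?_
    exact ⟨h.symm w, hA h.symm w hw, h.apply_symm_apply w⟩

theorem isCompleteSubTBA_invariantSets : IsCompleteSubTBA W (invariantSets W) where
  compl_mem A hA := by
    rw [mem_invariantSets_iff] at hA ⊢
    intro h w hw hhw
    have := hA h.symm _ hhw
    rw [h.symm_apply_apply] at this
    exact hw this
  sUnion_mem G hG := by
    rw [mem_invariantSets_iff]
    rintro h w ⟨A, hA, hw⟩
    exact ⟨A, hA, mem_invariantSets_iff.1 (hG hA) h w hw⟩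
  derivedSet_mem A hA := by
    rw [mem_invariantSets_iff]
    intro h w hw
    have := h.continuous.image_derivedSet (A := A) h.injective ⟨w, hw, rfl⟩
    rwa [hA h] at this

theorem primeTBA_subset_invariantSets : primeTBA W ⊆ invariantSets W :=
  fun _ hA => hA _ isCompleteSubTBA_invariantSets

/-- The smallest element of the prime TBA containing `w`. -/
def primeAtom (w : W) : Set W := ⋂ A : {A : Set W // A ∈ primeTBA W ∧ w ∈ A}, A.1

theorem primeAtom_mem_primeTBA (w : W) : primeAtom w ∈ primeTBA W :=
  iInter_mem_primeTBA fun A => A.2.1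

theorem mem_primeAtom_self (w : W) : w ∈ primeAtom w := Set.mem_iInter.2 fun A => A.2.2

theorem primeAtom_subset {A : Set W} (hA : A ∈ primeTBA W) {w : W} (hw : w ∈ A) :
    primeAtom w ⊆ A :=
  Set.iInter_subset (fun A : {A : Set W // A ∈ primeTBA W ∧ w ∈ A} => A.1) ⟨A, hA, hw⟩

/-- If `w` were outside the atom of `v`, removing that atom from the atom of `w` would leave a
smaller member containing `w`. -/
theorem primeAtom_eq_of_mem {v w : W} (hv : v ∈ primeAtom w) : primeAtom v = primeAtom w := by
  refine (primeAtom_subset (primeAtom_mem_primeTBA w) hv).antisymm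
    (primeAtom_subset (primeAtom_mem_primeTBA v) ?_)
  by_contra hw
  exact (primeAtom_subset (diff_mem_primeTBA (primeAtom_mem_primeTBA w) (primeAtom_mem_primeTBA v))
    ⟨mem_primeAtom_self w, hw⟩ hv).2 (mem_primeAtom_self v)

theorem homeoOrbit_subset_primeAtom (w : W) : homeoOrbit w ⊆ primeAtom w := by
  rintro _ ⟨h, rfl⟩
  exact mem_invariantSets_iff.1 (primeTBA_subset_invariantSets (primeAtom_mem_primeTBA w)) h w
    (mem_primeAtom_self w)

theorem homeoOrbit_subset_of_mem_primeTBA {A : Set W} (hA : A ∈ primeTBA W) {w : W} (hw : w ∈ A) :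
    homeoOrbit w ⊆ A :=
  (homeoOrbit_subset_primeAtom w).trans (primeAtom_subset hA hw)

theorem homeoOrbit_eq_of_mem {v w : W} (h : v ∈ homeoOrbit w) : homeoOrbit v = homeoOrbit w := by
  obtain ⟨g, rfl⟩ := h
  ext x
  constructor
  · rintro ⟨h, rfl⟩
    exact ⟨g.trans h, rfl⟩
  · rintro ⟨h, rfl⟩
    exact ⟨g.symm.trans h, by simp⟩

theorem isPartition_orbitDiagram (W : Type*) [TopologicalSpace W] :
    Setoid.IsPartition (orbitDiagram W) := by
  refine ⟨?_, fun w => ⟨homeoOrbit w, ⟨⟨w, rfl⟩, mem_homeoOrbit_self w⟩, ?_⟩⟩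
  · rintro ⟨w, hw⟩
    have := mem_homeoOrbit_self w
    rw [hw] at this
    exact this
  · rintro _ ⟨⟨v, rfl⟩, hw⟩
    exact (homeoOrbit_eq_of_mem hw).symm

/-- The set of points whose atom has closure `c`. -/
def closureClass (c : Set W) : Set W := {w | closure (primeAtom w) = c}

theorem primeAtom_subset_closureClass {c : Set W} {w : W} (hw : w ∈ closureClass c) :
    primeAtom w ⊆ closureClass c := fun v hv => by
  rw [closureClass, Set.mem_ofPred_eq, primeAtom_eq_of_mem hv]
  exact hw

theorem closureClass_mem_primeTBA (c : Set W) : closureClass c ∈ primeTBA W := by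
  have : closureClass c = ⋃ w : closureClass c, primeAtom w.1 := by
    refine Set.Subset.antisymm (fun w hw => Set.mem_iUnion.2 ⟨⟨w, hw⟩, mem_primeAtom_self w⟩) ?_
    exact Set.iUnion_subset fun w => primeAtom_subset_closureClass w.2
  rw [this]
  exact iUnion_mem_primeTBA fun w => primeAtom_mem_primeTBA w.1

/-- A member of the prime TBA containing `w` contains its atom, and if closed, the closure too.
Closed members thus cannot separate points whose atoms have equal closure. -/
theorem subset_of_mem_closureClass {c S : Set W} {w : W} (hw : w ∈ closureClass c)
    (hS : S ∈ primeTBA W) (hSc : IsClosed S) (hwS : w ∈ S) : c ⊆ S := by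
  rw [← show closure (primeAtom w) = c from hw]
  exact closure_minimal (primeAtom_subset hS hwS) hSc

theorem closureClass_subset (c : Set W) : closureClass c ⊆ c := by
  intro w hw
  have : w ∈ closure (primeAtom w) := subset_closure (mem_primeAtom_self w)
  rwa [show closure (primeAtom w) = c from hw] at this

end PrimeTBA

/-! ### Recovering canonical classes and orbits inside the prime TBA -/

section Separation

variable (W : Type*) [TopologicalSpace W] [T2Space W]

/-- The closures of the atoms of points of the canonical partition. -/
def CleanClosure : Type _ :=
  {c : Set W // ∃ p, ∃ w ∈ canonicalPartition W p, w ∈ closureClass c}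

variable {W}

/-- The partition of the clean points by the closures of their atoms. -/
def cleanClosureClass (c : CleanClosure W) : Set W := closureClass c.1

/-- The relation on closures of atoms given by limit points. -/
def cleanClosureLT (c d : CleanClosure W) : Prop :=
  cleanClosureClass c ⊆ derivedSet (cleanClosureClass d)

/-- The derived set of a class is a closed member of the prime TBA, so one point of class `c` in it
brings in the whole closed set `c`. -/
theorem cleanClosureLT_of_mem {c d : CleanClosure W} {w : W} (hw : w ∈ cleanClosureClass c)
    (hd : w ∈ derivedSet (cleanClosureClass d)) : cleanClosureLT c d :=
  (closureClass_subset c.1).trans (subset_of_mem_closureClass hw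
    (derivedSet_mem_primeTBA (closureClass_mem_primeTBA d.1)) (isClosed_derivedSet _) hd)

theorem isPPartition_cleanClosureClass :
    IsPPartition cleanClosureLT (cleanClosureClass (W := W)) := by
  have hne : ∀ c : CleanClosure W, (cleanClosureClass c).Nonempty := by
    rintro ⟨c, p, w, -, hw⟩
    exact ⟨w, hw⟩
  have hclosed : ∀ c : CleanClosure W, IsClosed c.1 := by
    rintro ⟨_, p, w, -, rfl⟩
    exact isClosed_closure
  -- The relation implies inclusion of the closed sets that index the classes, whence antisymmetry.
  have hle : ∀ c d : CleanClosure W, cleanClosureLT c d → c.1 ⊆ d.1 := by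
    intro c d h
    obtain ⟨w, hw⟩ := hne c
    refine (subset_of_mem_closureClass hw
      (derivedSet_mem_primeTBA (closureClass_mem_primeTBA d.1)) (isClosed_derivedSet _)
      (h hw)).trans ?_
    exact (derivedSet_subset_closure _).trans
      (closure_minimal (closureClass_subset d.1) (hclosed d))
  refine isPPartition_of_mem_derivedSet_iff ⟨fun c d e hcd hde => ?_, fun c d hcd hdc => ?_⟩ hne
    (fun c d w hc hd => ?_) (fun c d w hw => ⟨cleanClosureLT_of_mem hw, fun h => h hw⟩)
  · refine hcd.trans ((derivedSet_mono _ _ hde).trans ?_)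
    exact (isClosed_iff_derivedSet_subset _).1 (isClosed_derivedSet _)
  · exact Subtype.ext ((hle c d hcd).antisymm (hle d c hdc))
  · exact Subtype.ext ((show closure (primeAtom w) = c.1 from hc).symm.trans hd)

variable [LocallyCompactSpace W] [TotallyDisconnectedSpace W] [Countable (CompactOpens W)]

/-- Here `I_w` is the principal ideal of `p` and is contained in `I_y`, so `w` is a limit of the
orbit of `y` unless the ideals agree and `p ≮ p`. In that case `y` is also in `X p`, which meets `A`
only once. -/
theorem HasClass.eq_or_mem_derivedSet_homeoOrbit (hW : IsPrimitive W) {p : StructureDiagram W}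
    {A : CompactOpens W} (hA : HasClass p A) {w y : W} (hw : w ∈ A)
    (hwp : w ∈ canonicalPartition W p) (hy : y ∈ A) : y = w ∨ w ∈ derivedSet (homeoOrbit y) := by
  have hT := isTrimPartition_canonicalPartition hW
  have hPO := hT.isPPartition.poSystem
  have hpy : p ∈ trimTypes (structureLT W) (canonicalPartition W) y := ⟨A, hA.isTrimSet hW, hy⟩
  have hwI := hT.mem_iff_trimTypes_eq.1 hwp
  have hideal : hT.isPretrim.ideal w = hPO.principal p := Subtype.ext hwI
  rw [homeoOrbit_eq_idPartition hW, hT.mem_derivedSet_idPartition_iff, hideal]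
  rcases leOf_idLT_iff.2 (show (hPO.principal p).1 ⊆ (hT.isPretrim.ideal y).1 from
    (hT.isPretrim.ideal y).2.principalIdeal_subset_iff.2 hpy) with h | h
  · exact Or.inr h
  · by_cases hp : structureLT W p p
    · right
      rw [← h]
      exact (idLT_principal_self_iff hPO p).2 hp
    · left
      have hyp : y ∈ canonicalPartition W p :=
        hT.mem_iff_trimTypes_eq.2 (congrArg Subtype.val h).symm
      exact (hA.isTrimSet hW).eq_of_mem hp hy hyp hw hwp

/-- Every point of `A` other than `w` has `w` as a limit of its orbit, hence of its closure class,
so `c` lies below every class that meets `A`. -/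
theorem HasClass.isTrimSet_cleanClosureClass (hW : IsPrimitive W) {p : StructureDiagram W}
    {A : CompactOpens W} (hA : HasClass p A) {w : W} (hw : w ∈ A)
    (hwp : w ∈ canonicalPartition W p) {c : CleanClosure W} (hc : w ∈ cleanClosureClass c) :
    IsTrimSet cleanClosureLT cleanClosureClass c (A : Set W) := by
  have key : ∀ d, ∀ y ∈ A, y ∈ cleanClosureClass d → y = w ∨ cleanClosureLT c d := by
    intro d y hy hd
    refine (hA.eq_or_mem_derivedSet_homeoOrbit hW hw hwp hy).imp_right fun h => ?_
    exact cleanClosureLT_of_mem hc (derivedSet_mono _ _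
      ((homeoOrbit_subset_primeAtom y).trans (primeAtom_subset_closureClass hd)) h)
  refine isPPartition_cleanClosureClass.isTrimSet (fun d y hy hd => ?_) hw hc fun hcc y hy hyc =>
    (key c y hy hyc).resolve_right hcc
  rcases key d y hy hd with rfl | h
  · exact Or.inr (isPPartition_cleanClosureClass.eq_of_mem hc hd)
  · exact Or.inl h

theorem exists_hasClass_mem_subset (hW : IsPrimitive W) {w : W} {U : Set W} (hU : U ∈ 𝓝 w) :
    ∃ p, ∃ A : CompactOpens W, HasClass p A ∧ w ∈ A ∧ (A : Set W) ⊆ U ∧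
      ∃ v ∈ A, v ∈ canonicalPartition W p := by
  obtain ⟨p, A, hA, hwA, hAU⟩ := (isPretrim_canonicalPartition hW).exists_isTrimSet hU
  have hA' := (isTrimSet_canonicalPartition_iff hW).1 hA
  exact ⟨p, A, hA', hwA, hAU, hA'.exists_mem⟩

/-- The point `y` is not yet known to be in the canonical partition; it only shares its atom's
closure with such a point `w`. The union `S` of the classes not above `d` has a closure that misses
`w`, hence `y`, since closed members do not separate them. So in a small PI set around `y` the
central point `v` has class at least `d`, and trimness of that set gives the reverse. -/
theorem exists_hasClass_of_mem_cleanClosureClass (hW : IsPrimitive W) {d : CleanClosure W} {y : W}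
    (hy : y ∈ cleanClosureClass d) {U : Set W} (hU : U ∈ 𝓝 y) :
    ∃ q, ∃ B : CompactOpens W, HasClass q B ∧ y ∈ B ∧ (B : Set W) ⊆ U ∧
      ∃ v ∈ B, v ∈ canonicalPartition W q ∧ v ∈ cleanClosureClass d := by
  have hP := isPPartition_cleanClosureClass (W := W)
  obtain ⟨p, w, hwp, hwd⟩ := d.2
  obtain ⟨A, hA, hwA, -⟩ := mem_canonicalPartition_iff.1 hwp Set.univ Filter.univ_mem
  have hAd := hA.isTrimSet_cleanClosureClass hW hwA hwp (c := d) hwd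
  set S := ⋃ e : {e : CleanClosure W // ¬ leOf cleanClosureLT d e}, cleanClosureClass e.1
  have hS : S ∈ primeTBA W := iUnion_mem_primeTBA fun e => closureClass_mem_primeTBA e.1.1
  have hwS : w ∉ closure S := by
    intro hw
    obtain ⟨v, hvA, hv⟩ := mem_closure_iff.1 hw A A.isOpen hwA
    obtain ⟨e, hve⟩ := Set.mem_iUnion.1 hv
    exact e.2 (hAd.le_of_mem hvA hve)
  have hyS : y ∉ closure S := fun h => hwS (subset_of_mem_closureClass hy
    (closure_mem_primeTBA hS) isClosed_closure h (closureClass_subset _ hwd))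
  obtain ⟨q, B, hB, hyB, hBU, v, hvB, hvq⟩ := exists_hasClass_mem_subset hW
    (Filter.inter_mem hU (isClosed_closure.isOpen_compl.mem_nhds hyS))
  let c : CleanClosure W := ⟨closure (primeAtom v), q, v, hvq, rfl⟩
  have hvc : v ∈ cleanClosureClass c := rfl
  have hcd : leOf cleanClosureLT c d :=
    (hB.isTrimSet_cleanClosureClass hW hvB hvq hvc).le_of_mem hyB hy
  have hdc : leOf cleanClosureLT d c := by
    by_contra h
    exact (hBU hvB).2 (subset_closure (Set.mem_iUnion.2 ⟨⟨c, h⟩, hvc⟩))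
  rw [hP.poSystem.le_antisymm hcd hdc] at hvc
  exact ⟨q, B, hB, hyB, fun u hu => (hBU hu).1, v, hvB, hvq, hvc⟩

theorem isPretrim_cleanClosureClass (hW : IsPrimitive W) :
    IsPretrim cleanClosureLT (cleanClosureClass (W := W)) where
  isPPartition := isPPartition_cleanClosureClass
  t1 w U hU := by
    obtain ⟨p, A, hA, hwA, hAU, v, hv, hvp⟩ := exists_hasClass_mem_subset hW hU
    exact ⟨⟨closure (primeAtom v), p, v, hvp, rfl⟩, A,
      hA.isTrimSet_cleanClosureClass hW hv hvp rfl, hwA, hAU⟩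
  t3 d y hy := by
    obtain ⟨q, B, hB, hyB, -, v, hvB, hvq, hvd⟩ :=
      exists_hasClass_of_mem_cleanClosureClass hW hy Filter.univ_mem
    exact ⟨B, hB.isTrimSet_cleanClosureClass hW hvB hvq hvd, hyB⟩

/-- Points of `X p` share an orbit, hence an atom. Conversely, small PI neighbourhoods of a point in
the closure class are trim of the same type as `A` for the partition by closures, so uniqueness
makes them isomorphic to `A`, that is, of class `p`. -/
theorem canonicalPartition_eq_closureClass (hW : IsPrimitive W) {p : StructureDiagram W} {w : W}
    (hw : w ∈ canonicalPartition W p) :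
    canonicalPartition W p = closureClass (closure (primeAtom w)) := by
  have hT := isTrimPartition_canonicalPartition hW
  refine Set.Subset.antisymm (fun v hv => ?_) fun y hy => ?_
  · have : v ∈ homeoOrbit w := (mem_homeoOrbit_iff hW).2
      ((hT.mem_iff_trimTypes_eq.1 hv).trans (hT.mem_iff_trimTypes_eq.1 hw).symm)
    exact primeAtom_subset_closureClass rfl (homeoOrbit_subset_primeAtom w this)
  · let d : CleanClosure W := ⟨closure (primeAtom w), p, w, hw, rfl⟩
    obtain ⟨A, hA, hwA, -⟩ := mem_canonicalPartition_iff.1 hw Set.univ Filter.univ_mem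
    have hAd := hA.isTrimSet_cleanClosureClass hW hwA hw (c := d) rfl
    refine mem_canonicalPartition_iff.2 fun U hU => ?_
    obtain ⟨q, B, hB, hyB, hBU, v, hvB, hvq, hvd⟩ :=
      exists_hasClass_of_mem_cleanClosureClass hW (d := d) hy hU
    obtain rfl := hA.eq hB ((isPretrim_cleanClosureClass hW).idealIso hAd
      (hB.isTrimSet_cleanClosureClass hW hvB hvq hvd))
    exact ⟨B, hB, hyB, hBU⟩

theorem canonicalPartition_mem_primeTBA (hW : IsPrimitive W) (p : StructureDiagram W) :
    canonicalPartition W p ∈ primeTBA W := by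
  obtain ⟨w, hw⟩ := (isPretrim_canonicalPartition hW).isPPartition.nonempty p
  rw [canonicalPartition_eq_closureClass hW hw]
  exact closureClass_mem_primeTBA _

/-- A point has a `p`-trim neighbourhood exactly when it is not in the closure of the union of the
`X q` with `p ≰ q`. If it is outside, a small PI neighbourhood has type above `p`, and `I_w` is a
lower set. -/
theorem setOf_mem_trimTypes_mem_primeTBA (hW : IsPrimitive W) (p : StructureDiagram W) :
    {w | p ∈ trimTypes (structureLT W) (canonicalPartition W) w} ∈ primeTBA W := by
  have hpre := isPretrim_canonicalPartition hW
  have : {w | p ∈ trimTypes (structureLT W) (canonicalPartition W) w} =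
      (closure (⋃ q : {q // ¬ leOf (structureLT W) p q}, canonicalPartition W q.1))ᶜ := by
    ext w
    constructor
    · rintro ⟨A, hA, hw⟩ hcl
      obtain ⟨v, hvA, hv⟩ := mem_closure_iff.1 hcl A hA.isOpen hw
      obtain ⟨q, hvq⟩ := Set.mem_iUnion.1 hv
      exact q.2 (hA.le_of_mem hvA hvq)
    · intro hw
      obtain ⟨q, B, hB, hwB, hBU, v, hvB, hvq⟩ := exists_hasClass_mem_subset hW
        (isClosed_closure.isOpen_compl.mem_nhds hw)
      have hpq : leOf (structureLT W) p q := by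
        by_contra h
        exact hBU hvB (subset_closure (Set.mem_iUnion.2 ⟨⟨q, h⟩, hvq⟩))
      exact (hpre.isIdeal_trimTypes w).lower p q hpq ⟨B, hB.isTrimSet hW, hwB⟩
  rw [this]
  exact compl_mem_primeTBA (closure_mem_primeTBA
    (iUnion_mem_primeTBA fun q => canonicalPartition_mem_primeTBA hW q.1))

theorem homeoOrbit_mem_primeTBA (hW : IsPrimitive W) (w : W) : homeoOrbit w ∈ primeTBA W := by
  have : homeoOrbit w = ⋂ p : StructureDiagram W,
      {x | p ∈ trimTypes (structureLT W) (canonicalPartition W) x ↔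
        p ∈ trimTypes (structureLT W) (canonicalPartition W) w} := by
    ext x
    rw [mem_homeoOrbit_iff hW, Set.ext_iff, Set.mem_iInter]
    rfl
  rw [this]
  refine iInter_mem_primeTBA fun p => ?_
  have hp := setOf_mem_trimTypes_mem_primeTBA hW p
  by_cases hpw : p ∈ trimTypes (structureLT W) (canonicalPartition W) w
  · simpa only [hpw, iff_true] using hp
  · simpa only [hpw, iff_false, Set.compl_ofPred] using compl_mem_primeTBA hp

theorem primeTBA_eq_invariantSets (hW : IsPrimitive W) : primeTBA W = invariantSets W := by
  refine primeTBA_subset_invariantSets.antisymm fun A hA => ?_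
  have : A = ⋃ w : A, homeoOrbit w.1 := by
    refine Set.Subset.antisymm (fun w hw => Set.mem_iUnion.2 ⟨⟨w, hw⟩, mem_homeoOrbit_self w⟩) ?_
    refine Set.iUnion_subset fun w => ?_
    rintro _ ⟨h, rfl⟩
    exact mem_invariantSets_iff.1 hA h w.1 w.2
  rw [this]
  exact iUnion_mem_primeTBA fun w => homeoOrbit_mem_primeTBA hW w.1

theorem primeTBAAtoms_eq_orbitDiagram (hW : IsPrimitive W) :
    primeTBAAtoms W = orbitDiagram W := by
  ext A
  constructor
  · rintro ⟨⟨hA, w, hw⟩, hmin⟩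
    have hsub := homeoOrbit_subset_of_mem_primeTBA hA hw
    exact ⟨w, hsub.antisymm
      (hmin ⟨homeoOrbit_mem_primeTBA hW w, w, mem_homeoOrbit_self w⟩ hsub)⟩
  · rintro ⟨w, rfl⟩
    refine ⟨⟨homeoOrbit_mem_primeTBA hW w, w, mem_homeoOrbit_self w⟩, ?_⟩
    rintro B ⟨hB, v, hv⟩ hBw
    rw [← homeoOrbit_eq_of_mem (hBw hv)]
    exact homeoOrbit_subset_of_mem_primeTBA hB hv

end Separation

end PrimitiveSpace

theorem mainTheorem10 (W : Type*) [TopologicalSpace W] [T2Space W] [LocallyCompactSpace W]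
    [TotallyDisconnectedSpace W] [Countable (CompactOpens W)] (hW : IsPrimitive W) :
    -- the canonical partition is a trim partition indexed by the structure diagram
    IsTrimPartition (structureLT W) (canonicalPartition W) ∧
    -- its ideal completion is the orbit diagram, as a partition and as a PO system
    IsPOSystem (orbitLT W) ∧
    (∃ e : IdealCompletion (structureLT W) ≃ orbitDiagram W,
      (∀ J K, idLT (structureLT W) J K ↔ orbitLT W (e J) (e K)) ∧
      (∀ J, idPartition (structureLT W) (canonicalPartition W) J = orbitPartition W (e J))) ∧
    -- the orbit diagram regularly consolidates the (complete) ideal completion of every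
    -- trim partition
    (∀ (Q : Type*) (lt : Q → Q → Prop) (Y : Q → Set W), IsTrimPartition lt Y →
      (⋃ J, idPartition lt Y J) = Set.univ ∧
      ∃ α : IdealCompletion lt → orbitDiagram W,
        RegularlyRefines (idLT lt) (idPartition lt Y) (orbitLT W) (orbitPartition W) α) ∧
    -- the atoms of the prime TBA are the orbits, and the prime TBA consists of all invariant sets
    (Setoid.IsPartition (primeTBAAtoms W) ∧ primeTBAAtoms W = orbitDiagram W) ∧
    primeTBA W = invariantSets W := by
  exact ⟨isTrimPartition_canonicalPartition hW, (isPPartition_orbitPartition hW).poSystem,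
    exists_equiv_orbitDiagram hW,
    fun Q lt Y hY => ⟨hY.isPretrim.iUnion_idPartition, exists_regularlyRefines hW hY⟩,
    ⟨primeTBAAtoms_eq_orbitDiagram hW ▸ isPartition_orbitDiagram W,
      primeTBAAtoms_eq_orbitDiagram hW⟩,
    primeTBA_eq_invariantSets hW⟩
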